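/- **Setting.** Let $\mathcal A=\{\alpha,\beta\}$ be the set of actions and $\mathcal E=\{0,1\}\times\{0,1\}$ the set of percepts $e=(o,r)$ (observation, reward). A history of length $t$ is a string $a_1e_1\dots a_te_t\in(\mathcal A\times\mathcal E)^*$, and a policy is a function $\pi:(\mathcal A\times\mathcal E)^*\to\mathcal A$, identified with the relation $\{(h,a):\pi(h)=a\}$ (a set of natural numbers via the usual encoding). Let $\mathcal M$ be the class of all lower semicomputable chronological conditional semimeasures, i.e. functions $\nu(e_{1:t}\,\|\,a_{1:t})\ge 0$ with $\nu(\epsilon)\le 1$ and $\sum_{e\in\mathcal E}\nu(e_{1:t}e\,\|\,a_{1:t}a)\le\nu(e_{1:t}\,\|\,a_{1:t})$ for which $\{(a_{1:t},e_{1:t},q): q\in\mathbb Q,\ q<\nu(e_{1:t}\,\|\,a_{1:t})\}$ is recursively enumerable. A (chronological) monotone machine $T$ reads random bits from a one-way input tape and actions one at a time, and writes its $k$-th percept on a one-way output tape after having seen the actions $a_{1:k}$ only; $\lambda_T(e_{1:t}\,\|\,a_{1:t})$ denotes the probability that, fed with uniformly random bits and with $a_{1:t}$, it outputs a string starting with $e_{1:t}$.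 A universal Turing machine is a monotone machine $U$ with a computable prefix-free code $c:\mathbb N\to\{0,1\}^*$ such that $U(c(i)p)=T_i(p)$, where $T_0,T_1,\dots$ runs through all monotone machines, and $U$ produces no output on programs that do not start with a code word. It gives rise to the universal prior $w_\nu:=\sum_{i:\lambda_{T_i}=\nu}2^{-|c(i)|}$ and to the universal mixture $\xi_U:=\sum_{\nu\in\mathcal M}w_\nu\,\nu$. A discount function is a lower semicomputable $\gamma:\mathbb N\to[0,\infty)$ with $\sum_t\gamma_t<\infty$ and $\Gamma_t:=\sum_{i\ge t}\gamma_i>0$ for all $t$. The (iterative) value of a policy $\pi$ in the environment $\nu$ after a history $h=a_1e_1\dots a_{t-1}e_{t-1}$ is $$V^\pi_\nu(h):=\frac1{\Gamma_t}\lim_{m\to\infty}\sum_{e_{t:m}}\Bigl(\sum_{k=t}^m\gamma_kr_k\Bigr)\frac{\nu(e_{1:m}\,\|\,a_{1:m})}{\nu(e_{<t}\,\|\,a_{<t})},$$ where $a_i$ for $i\ge t$ is the action that $\pi$ takes after $a_1e_1\dots a_{i-1}e_{i-1}$. Let $V^*_\nu(h):=\sup_\pi V^\pi_\nu(h)$,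 and let $V^*_\nu(ha)$ be the supremum of $V^{\pi}_\nu(h)$ over the policies $\pi$ with $\pi(h)=a$. A policy $\pi$ is $\varepsilon$-optimal for $\xi$ if $V^*_\xi(h)-V^\pi_\xi(h)<\varepsilon$ for all histories $h$. AIXI (for $\xi$) is any policy $\pi$ with $\pi(h)\in\arg\max_{a}V^*_\xi(ha)$ for all histories $h$. A set $P$ is $\Sigma^0_2$ if $x\in P\Leftrightarrow\exists k_1\forall k_2\,S(x,k_1,k_2)$ for a computable relation $S$; it is $\Pi^0_2$ if its complement is $\Sigma^0_2$, and limit computable ($\Delta^0_2$) if it is both. It is $\Pi^0_2$-hard if every $\Pi^0_2$ set $B\subseteq\mathbb N$ is many-one reducible to it. **Theorem** (Some $\varepsilon$-optimal $\mathrm{AIXI}_{\mathrm{DC}}$ are $\Pi^0_2$-hard). There are a universal Turing machine $U'$ and an $\varepsilon>0$ such that, for every discount function $\gamma$, every policy that is $\varepsilon$-optimal for $\xi_{U'}$ is $\Pi^0_2$-hard and, in particular, is not limit computable. Likewise, AIXI for $\xi_{U'}$ itself (with argmax ties broken in any way) is $\Pi^0_2$-hard and hence not limit computable. -/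

import Mathlib

open MeasureTheory Filter

noncomputable section

namespace AIXI

/-! ## Levels of the arithmetical hierarchy and hardness -/

/-- `Σ⁰₂` predicates: `x ∈ P ↔ ∃ k₁, ∀ k₂, S (x, k₁, k₂)` for a computable relation `S`. -/
def IsSigma2 {α : Type} [Primcodable α] (P : α → Prop) : Prop :=
  ∃ S : α × ℕ × ℕ → Prop, ComputablePred S ∧ ∀ x, P x ↔ ∃ k₁, ∀ k₂, S (x, k₁, k₂)

/-- `Π⁰₂` predicates: the complements of `Σ⁰₂` predicates. -/
def IsPi2 {α : Type} [Primcodable α] (P : α → Prop) : Prop :=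
  IsSigma2 fun x => ¬ P x

/-- `Δ⁰₂`, i.e. limit computable, predicates. -/
def IsDelta2 {α : Type} [Primcodable α] (P : α → Prop) : Prop :=
  IsSigma2 P ∧ IsPi2 P

/-- `P` is `Π⁰₂`-hard: every `Π⁰₂` set of natural numbers is many-one reducible to `P`. -/
def IsPi2Hard {α : Type} [Primcodable α] (P : α → Prop) : Prop :=
  ∀ B : ℕ → Prop, IsPi2 B → ManyOneReducible B P

/-- An encoding of the rational numbers: the triple `(m, n, d)` stands for `(m - n) / (d + 1)`. -/
def ratOf (c : ℕ × ℕ × ℕ) : ℚ := ((c.1 : ℚ) - (c.2.1 : ℚ)) / ((c.2.2 : ℚ) + 1)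

/-- `f` is lower semicomputable: the set of all `(x, q)` with `q` rational and `q < f x` is
recursively enumerable. -/
def LowerSemicomputable {α : Type} [Primcodable α] (f : α → ℝ) : Prop :=
  REPred fun x : α × (ℕ × ℕ × ℕ) => (ratOf x.2 : ℝ) < f x.1

/-! ## Agents and environments -/

/-- The two actions `α`, `β`. -/
abbrev Action := Bool

/-- A percept is a pair of a binary observation and a binary reward. -/
abbrev Percept := Bool × Bool

/-- The reward in `{0, 1}` that a percept carries. -/
def reward (e : Percept) : ℝ := if e.2 then 1 else 0

/-- A history `a₁ e₁ a₂ e₂ … aₜ eₜ`. -/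
abbrev History := List (Action × Percept)

/-- A (deterministic) policy chooses the next action from the history so far. -/
abbrev Policy := History → Action

/-- The relation between histories and actions that represents a policy. -/
def Policy.graph (π : Policy) : History × Action → Prop := fun x => π x.1 = x.2

/-- Lower semicomputable chronological conditional semimeasures.
The value `ν(e₁ … eₜ ‖ a₁ … aₜ)` is written `ν [(a₁, e₁), …, (aₜ, eₜ)]`; that `ν` is chronological,
i.e. that it does not depend on the actions after time `t`, is built into its type. -/
structure IsLSCCCS (ν : History → ℝ) : Prop where
  nonneg : ∀ h, 0 ≤ ν h
  nil_le_one : ν [] ≤ 1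
  sum_le : ∀ (h : History) (a : Action), ∑ e : Percept, ν (h ++ [(a, e)]) ≤ ν h
  lowerSemicomputable : LowerSemicomputable ν

/-- The class of all lower semicomputable chronological conditional semimeasures. -/
abbrev EnvClass := {ν : History → ℝ // IsLSCCCS ν}

/-! ## Monotone machines and the universal mixture -/

/-- A chronological monotone Turing machine, given by the partial recursive function it computes:
`e ∈ run (p, a)` means that, having read no bits but those of `p` from its random input tape and
the actions `a = a₁ … aₜ`, the machine has written the percepts `e = e₁ … eₜ` on its one-way
output tape, the `k`-th percept being written in answer to the first `k` actions. -/
structure MonotoneMachine where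
  run : List Bool × List Action →. List Percept
  partrec : Partrec run
  length_eq : ∀ p a e, e ∈ run (p, a) → e.length = a.length
  mono : ∀ p q a e, p <+: q → e ∈ run (p, a) → e ∈ run (q, a)
  chronological : ∀ p a b e, e ∈ run (p, a ++ b) → e.take a.length ∈ run (p, a)

/-- The distribution of an infinite sequence of independent fair coin flips. -/
def coinFlips : Measure (ℕ → Bool) :=
  Measure.infinitePi fun _ => (PMF.uniformOfFintype Bool).toMeasure

/-- The semimeasure computed by a machine: the probability that, fed with uniformly random bits
and the actions of the history, the machine outputs (a string that starts with) the percepts of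
the history. -/
def MonotoneMachine.outputProb (T : MonotoneMachine) (h : History) : ℝ :=
  coinFlips.real
    {ω | ∃ n : ℕ, h.map Prod.snd ∈ T.run (List.ofFn (fun i : Fin n => ω i), h.map Prod.fst)}

/-- A universal monotone machine `U`: there is a computable prefix-free code such that
`U (code i ++ p) = Tᵢ p`, where `T₀, T₁, …` runs through all monotone machines, and `U` has no
output on programs that do not begin with a code word. -/
structure UniversalMachine extends MonotoneMachine where
  code : ℕ → List Bool
  code_computable : Computable code
  code_prefixFree : ∀ i j, code i <+: code j → i = j
  simulates : ∀ T : MonotoneMachine, ∃ i, ∀ p a, run (code i ++ p, a) = T.run (p, a)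
  code_of_output : ∀ p a e, e ∈ run (p, a) → ∃ i, code i <+: p

/-- The `i`-th machine `Tᵢ` that a universal machine simulates. -/
def UniversalMachine.machine (U : UniversalMachine) (i : ℕ) : MonotoneMachine where
  run := fun x => U.run (U.code i ++ x.1, x.2)
  partrec := U.partrec.comp
    (Computable.pair
      (Primrec.list_append.to_comp.comp (Computable.const (U.code i)) Computable.fst)
      Computable.snd)
  length_eq := fun _ a e he => U.length_eq _ a e he
  mono := fun _ _ a e hpq he => U.mono _ _ a e ((List.prefix_append_right_inj _).2 hpq) he
  chronological := fun _ a b e he => U.chronological _ a b e he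

/-- The universal prior given by `U`: the weight of `ν` is the sum of `2 ^ (-|code i|)` over all
indices `i` of machines that compute `ν`, i.e. the probability that random bits begin with the code
word of a machine for `ν`. -/
def UniversalMachine.prior (U : UniversalMachine) (ν : EnvClass) : ℝ :=
  ∑' i : {i : ℕ // (U.machine i).outputProb = ν.1}, (1 / 2 : ℝ) ^ (U.code i).length

/-- The universal mixture `ξ = ∑_ν w_ν ν` over all lower semicomputable chronological conditional
semimeasures, with the universal prior `w` given by `U`. -/
def UniversalMachine.mixture (U : UniversalMachine) (h : History) : ℝ :=
  ∑' ν : EnvClass, U.prior ν * ν.1 h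

/-! ## Discounting, values and optimal policies -/

/-- The discount normalization `Γₜ = γₜ + γₜ₊₁ + …`. -/
def tailSum (γ : ℕ → ℝ) (t : ℕ) : ℝ := ∑' i : ℕ, γ (t + i)

/-- Discount functions with infinite horizon. Time steps are numbered from `1`. -/
structure IsDiscount (γ : ℕ → ℝ) : Prop where
  nonneg : ∀ t, 0 ≤ γ t
  summable : Summable γ
  tailSum_pos : ∀ t, 0 < tailSum γ t
  lowerSemicomputable : LowerSemicomputable γ

/-- The history that results from `h` if the agent follows `π` and receives the percepts `es`. -/
def follow (π : Policy) : History → List Percept → History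
  | h, [] => h
  | h, e :: es => follow π (h ++ [(π h, e)]) es

/-- The (iterative) value `V^π_ν(h)` of the policy `π` in the environment `ν` after a history `h` of
length `t - 1`, that is
`(1 / Γₜ) * lim_{m → ∞} ∑_{eₜ … eₘ} (γₜ rₜ + … + γₘ rₘ) * ν(e₁ … eₘ ‖ a₁ … aₘ) / ν(e₁ … eₜ₋₁ ‖ a₁ … aₜ₋₁)`,
where the actions from time `t` on are those of `π`. Here `n = m - t + 1`. -/
def value (γ : ℕ → ℝ) (ν : History → ℝ) (π : Policy) (h : History) : ℝ :=
  (1 / tailSum γ (h.length + 1)) *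
    limUnder atTop fun n : ℕ => ∑ e : Fin n → Percept,
      (∑ k : Fin n, γ (h.length + 1 + k) * reward (e k)) *
        (ν (follow π h (List.ofFn e)) / ν h)

/-- The optimal value `V^*_ν(h)`. -/
def optValue (γ : ℕ → ℝ) (ν : History → ℝ) (h : History) : ℝ :=
  ⨆ π : Policy, value γ ν π h

/-- The optimal value `V^*_ν(ha)` given that the action `a` is taken after the history `h`. -/
def optActionValue (γ : ℕ → ℝ) (ν : History → ℝ) (h : History) (a : Action) : ℝ :=
  ⨆ π : Policy, value γ ν (Function.update π h a) h

/-- `π` is `ε`-optimal in the environment `ν`. -/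
def IsEpsOptimal (γ : ℕ → ℝ) (ν : History → ℝ) (ε : ℝ) (π : Policy) : Prop :=
  ∀ h, optValue γ ν h - value γ ν π h < ε

/-- `π(h) ∈ argmax_a V^*_ν(ha)` for all histories `h`, where ties are broken in any way. -/
def IsArgmaxPolicy (γ : ℕ → ℝ) (ν : History → ℝ) (π : Policy) : Prop :=
  ∀ h a, optActionValue γ ν h a ≤ optActionValue γ ν h (π h)

end AIXI

end

noncomputable section
namespace AIXI
open Nat.Partrec (Code)
open Nat.Partrec.Code (evaln eval)
open Encodable (encode decode)

/-! ## An effective enumeration of all monotone machines -/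

/-! The iterative value weights rewards by the mass that survives to the horizon, so a semimeasure
that vanishes later annihilates even the rewards already collected. This lets a single action answer
a `Π⁰₂` question. In the environment `dominant` the agent names a number `x`, which stands for a
code with a parameter, by `x` actions `true` followed by `false`. If the next action is `false`,
reward 1 follows forever, but with mass only 1/2. If it is `true`, reward 1 follows with mass 1 as
long as the successive computations of `x` halt, and with mass 0 from the first divergent one on. So
`true` is worth 1 if `Total x` and 0 otherwise, against 1/2 for `false`.

The universal machine reserves the code words `0 ^ i 1` with `i < 5` for this environment, which
therefore has prior weight at least 31/32 (`le_prior_dominant`). All other environments together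
shift the values only a little (`le_value_of_dominant`, `value_le_of_dominant`), and a gap of at
least 29/64 between the two actions remains. Hence 1/4-optimal policies and argmax policies alike
take `true` after `queryHistory x` exactly when `Total x`. Every `Π⁰₂` set is a section of `Total`
(`IsPi2.exists_code`), which gives hardness; a diagonal argument then excludes limit computability.

Universality needs an effective list of all monotone machines. `outputOf c` turns any code into such
a machine by trusting only those stages at which the finite part of the graph found so far is
consistent; codes of genuine machines are left unchanged (`exists_outputOf_eq`). -/

theorem mem_rfindOpt_iff {α : Type} {f : ℕ → Option α}
    (hf : ∀ {m n a b}, a ∈ f m → b ∈ f n → a = b) {a : α} :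
    a ∈ Nat.rfindOpt f ↔ ∃ n, a ∈ f n := by
  refine ⟨Nat.rfindOpt_spec, fun ⟨n, hn⟩ => ?_⟩
  have hd := Part.get_mem (Nat.rfindOpt_dom.2 ⟨n, a, hn⟩)
  obtain ⟨m, hm⟩ := Nat.rfindOpt_spec hd
  rwa [hf hm hn] at hd

/-- The part of the graph of the partial function with code `c` that is found in `s` steps. -/
def stageGraph (c : Code) (s : ℕ) : List ((List Bool × List Action) × List Percept) :=
  (List.range s).filterMap fun n =>
    (decode (α := List Bool × List Action) n).bind fun x =>
      ((evaln s c (encode x)).bind (decode (α := List Percept))).map fun e => (x, e)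

theorem primrecRel_isPrefix {α : Type} [Primcodable α] :
    PrimrecRel fun l₁ l₂ : List α => l₁ <+: l₂ :=
  (Primrec.eq.comp Primrec.fst
    (Primrec.list_take.comp (Primrec.list_length.comp Primrec.fst) Primrec.snd)).of_eq
    fun _ => List.prefix_iff_eq_take.symm

theorem primrec_stageGraph : Primrec₂ stageGraph := by
  refine Primrec.listFilterMap (Primrec.list_range.comp Primrec.snd) ?_
  refine Primrec.option_bind (Primrec.decode.comp Primrec.snd) ?_
  refine Primrec.option_map (Primrec.option_bind (Nat.Partrec.Code.primrec_evaln.comp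
    (((Primrec.snd.comp (Primrec.fst.comp Primrec.fst)).pair
      (Primrec.fst.comp (Primrec.fst.comp Primrec.fst))).pair (Primrec.encode.comp Primrec.snd)))
    (Primrec.decode.comp Primrec.snd)) ?_
  exact (Primrec.snd.comp Primrec.fst).pair Primrec.snd

/-- `evaln s` succeeds only on inputs below `s`, so the bounded search in `stageGraph` misses
nothing. -/
theorem mem_stageGraph_iff {c : Code} {s : ℕ} {u : (List Bool × List Action) × List Percept} :
    u ∈ stageGraph c s ↔ ∃ m ∈ evaln s c (encode u.1), decode m = some u.2 := by
  obtain ⟨x, e⟩ := u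
  simp only [stageGraph, List.mem_filterMap, List.mem_range, Option.bind_eq_some_iff,
    Option.map_eq_some_iff, Prod.mk.injEq]
  constructor
  · rintro ⟨n, -, y, hy, e', ⟨m, hm, he⟩, rfl, rfl⟩
    exact ⟨m, hm, he⟩
  · rintro ⟨m, hm, he⟩
    exact ⟨_, Nat.Partrec.Code.evaln_bound hm, x, Encodable.encodek x, e, ⟨m, hm, he⟩, rfl, rfl⟩

theorem stageGraph_mono {c : Code} {s t : ℕ} (h : s ≤ t) : stageGraph c s ⊆ stageGraph c t := by
  intro u hu
  obtain ⟨m, hm, hd⟩ := mem_stageGraph_iff.1 hu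
  exact mem_stageGraph_iff.2 ⟨m, Nat.Partrec.Code.evaln_mono h hm, hd⟩

/-- Two elements of the graph of a partial function agree, up to time `l`, with the behaviour of a
chronological monotone machine. -/
def Compatible (u v : (List Bool × List Action) × List Percept) (l : ℕ) : Prop :=
  u.2.length = u.1.2.length ∧
    (u.1.1 <+: v.1.1 → u.1.2.take l = v.1.2.take l → u.2.take l = v.2.take l)

/-- The part of the graph that is found in `s` steps is that of a chronological monotone machine. -/
def Consistent (c : Code) (s : ℕ) : Prop :=
  ∀ u ∈ stageGraph c s, ∀ v ∈ stageGraph c s, ∀ l < s, Compatible u v l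

theorem primrecPred_compatible :
    PrimrecPred fun x : ℕ × ((List Bool × List Action) × List Percept) ×
      ((List Bool × List Action) × List Percept) => Compatible x.2.1 x.2.2 x.1 := by
  have agree : ∀ {α β γ δ : Type} [Primcodable α] [Primcodable β] [Primcodable γ] [Primcodable δ],
      PrimrecPred fun x : ℕ × ((List α × List β) × List γ) × ((List α × List δ) × List γ) =>
        x.2.1.2.take x.1 = x.2.2.2.take x.1 :=
    Primrec.eq.comp
      (Primrec.list_take.comp Primrec.fst (Primrec.snd.comp (Primrec.fst.comp Primrec.snd)))
      (Primrec.list_take.comp Primrec.fst (Primrec.snd.comp (Primrec.snd.comp Primrec.snd)))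
  have pre : ∀ {α β γ : Type} [Primcodable α] [Primcodable β] [Primcodable γ],
      PrimrecPred fun x : ℕ × ((List α × β) × γ) × ((List α × β) × γ) =>
        x.2.1.1.1 <+: x.2.2.1.1 :=
    primrecRel_isPrefix.comp
      (Primrec.fst.comp (Primrec.fst.comp (Primrec.fst.comp Primrec.snd)))
      (Primrec.fst.comp (Primrec.fst.comp (Primrec.snd.comp Primrec.snd)))
  have acts : ∀ {α β γ : Type} [Primcodable α] [Primcodable β] [Primcodable γ],
      PrimrecPred fun x : ℕ × ((α × List β) × γ) × ((α × List β) × γ) =>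
        x.2.1.1.2.take x.1 = x.2.2.1.2.take x.1 :=
    Primrec.eq.comp
      (Primrec.list_take.comp Primrec.fst
        (Primrec.snd.comp (Primrec.fst.comp (Primrec.fst.comp Primrec.snd))))
      (Primrec.list_take.comp Primrec.fst
        (Primrec.snd.comp (Primrec.fst.comp (Primrec.snd.comp Primrec.snd))))
  have len : ∀ {α β γ δ : Type} [Primcodable α] [Primcodable β] [Primcodable γ] [Primcodable δ],
      PrimrecPred fun x : ℕ × ((α × List β) × List γ) × δ =>
        x.2.1.2.length = x.2.1.1.2.length :=
    Primrec.eq.comp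
      (Primrec.list_length.comp (Primrec.snd.comp (Primrec.fst.comp Primrec.snd)))
      (Primrec.list_length.comp
        (Primrec.snd.comp (Primrec.fst.comp (Primrec.fst.comp Primrec.snd))))
  refine (len.and (pre.not.or (acts.not.or agree))).of_eq fun x => ?_
  simp only [Compatible, imp_iff_not_or]

theorem primrecRel_consistent : PrimrecRel Consistent := by
  have h₁ : PrimrecRel fun (s : ℕ) (x : ((List Bool × List Action) × List Percept) ×
      ((List Bool × List Action) × List Percept)) => ∀ l < s, Compatible x.1 x.2 l :=
    (primrecPred_compatible.primrecRel.forall_mem_list.comp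
      (Primrec.list_range.comp Primrec.fst) Primrec.snd).of_eq fun x => by simp
  have h₂ : PrimrecRel fun (v : (List Bool × List Action) × List Percept)
      (x : ℕ × ((List Bool × List Action) × List Percept)) =>
      ∀ l < x.1, Compatible x.2 v l :=
    h₁.comp (Primrec.fst.comp Primrec.snd) ((Primrec.snd.comp Primrec.snd).pair Primrec.fst)
  have h₃ : PrimrecRel fun (u : (List Bool × List Action) × List Percept)
      (x : Code × ℕ) => ∀ v ∈ stageGraph x.1 x.2, ∀ l < x.2, Compatible u v l :=
    h₂.forall_mem_list.comp (primrec_stageGraph.comp (Primrec.fst.comp Primrec.snd)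
      (Primrec.snd.comp Primrec.snd)) ((Primrec.snd.comp Primrec.snd).pair Primrec.fst)
  exact h₃.forall_mem_list.comp (primrec_stageGraph.comp Primrec.fst Primrec.snd) Primrec.id

open Classical in
/-- One step of the search for an output of the machine with code `c`. -/
def searchStep (c : Code) (x : List Bool × List Action) (n : ℕ) : Option (List Percept) :=
  ((stageGraph c n.unpair.1)[n.unpair.2]?).bind fun u =>
    if Consistent c n.unpair.1 ∧ u.1.1 <+: x.1 ∧ x.2 <+: u.1.2 ∧ x.2.length < n.unpair.1 then
      some (u.2.take x.2.length) else none

open Classical in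
theorem primrec_searchStep :
    Primrec₂ fun (x : Code × List Bool × List Action) (n : ℕ) => searchStep x.1 x.2 n := by
  have s : Primrec fun x : (Code × List Bool × List Action) × ℕ => x.2.unpair.1 :=
    Primrec.fst.comp (Primrec.unpair.comp Primrec.snd)
  have c : Primrec fun x : (Code × List Bool × List Action) × ℕ => x.1.1 :=
    Primrec.fst.comp Primrec.fst
  have a : Primrec fun x : (Code × List Bool × List Action) × ℕ => x.1.2.2 :=
    Primrec.snd.comp (Primrec.snd.comp Primrec.fst)
  have p : Primrec fun x : (Code × List Bool × List Action) × ℕ => x.1.2.1 :=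
    Primrec.fst.comp (Primrec.snd.comp Primrec.fst)
  refine Primrec.option_bind (Primrec.list_getElem?.comp (primrec_stageGraph.comp c s)
    (Primrec.snd.comp (Primrec.unpair.comp Primrec.snd))) ?_
  refine Primrec.ite (c := fun x : ((Code × List Bool × List Action) × ℕ) ×
      (List Bool × List Action) × List Percept => Consistent x.1.1.1 x.1.2.unpair.1 ∧
        x.2.1.1 <+: x.1.1.2.1 ∧ x.1.1.2.2 <+: x.2.1.2 ∧ x.1.1.2.2.length < x.1.2.unpair.1)
    (((primrecRel_consistent.comp c s).comp Primrec.fst).and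
    ((primrecRel_isPrefix.comp (Primrec.fst.comp (Primrec.fst.comp Primrec.snd))
      (p.comp Primrec.fst)).and ((primrecRel_isPrefix.comp (a.comp Primrec.fst)
      (Primrec.snd.comp (Primrec.fst.comp Primrec.snd))).and
      (Primrec.nat_lt.comp (Primrec.list_length.comp (a.comp Primrec.fst))
        (s.comp Primrec.fst))))) ?_ (Primrec.const none)
  exact Primrec.option_some.comp (Primrec.list_take.comp
    (Primrec.list_length.comp (a.comp Primrec.fst)) (Primrec.snd.comp Primrec.snd))

/-- `e` is an output of the monotone machine with code `c` on the input `x`. -/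
def IsOutput (c : Code) (x : List Bool × List Action) (e : List Percept) : Prop :=
  ∃ s, Consistent c s ∧ x.2.length < s ∧ ∃ u ∈ stageGraph c s,
    u.1.1 <+: x.1 ∧ x.2 <+: u.1.2 ∧ e = u.2.take x.2.length

theorem exists_mem_searchStep {c : Code} {x : List Bool × List Action} {e : List Percept} :
    (∃ n, e ∈ searchStep c x n) ↔ IsOutput c x e := by
  constructor
  · rintro ⟨n, hn⟩
    obtain ⟨u, hu, h⟩ := Option.bind_eq_some_iff.1 hn
    split_ifs at h with hc
    exact ⟨n.unpair.1, hc.1, hc.2.2.2, u, List.mem_of_getElem? hu, hc.2.1, hc.2.2.1,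
      (Option.some.inj h).symm⟩
  · rintro ⟨s, hs, hl, u, hu, hp, ha, rfl⟩
    obtain ⟨j, hj⟩ := List.mem_iff_getElem?.1 hu
    refine ⟨Nat.pair s j, ?_⟩
    simp [searchStep, hj, hs, hl, hp, ha]

/-- Both witnesses already lie in the later of the two consistent stages. Their programs are
prefixes of the same input, hence comparable, so compatibility at `l = x.2.length` forces agreement;
the bound `x.2.length < s` makes this `l` one of those tested. -/
theorem IsOutput.unique {c : Code} {x : List Bool × List Action} {e e' : List Percept}
    (h : IsOutput c x e) (h' : IsOutput c x e') : e = e' := by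
  obtain ⟨s, hs, hl, u, hu, hp, ha, rfl⟩ := h
  obtain ⟨s', hs', hl', u', hu', hp', ha', rfl⟩ := h'
  have key : ∀ t, Consistent c t → x.2.length < t → u ∈ stageGraph c t → u' ∈ stageGraph c t →
      u.2.take x.2.length = u'.2.take x.2.length := by
    intro t ht hlt hut hut'
    have htake : u.1.2.take x.2.length = u'.1.2.take x.2.length := by
      rw [← List.prefix_iff_eq_take.1 ha, ← List.prefix_iff_eq_take.1 ha']
    rcases List.prefix_or_prefix_of_prefix hp hp' with h | h
    · exact (ht u hut u' hut' _ hlt).2 h htake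
    · exact ((ht u' hut' u hut _ hlt).2 h htake.symm).symm
  rcases le_total s s' with h | h
  · exact key s' hs' hl' (stageGraph_mono h hu) hu'
  · exact key s hs hl hu (stageGraph_mono h hu')

/-- The partial function computed by the monotone machine with code `c`. -/
def outputOf (c : Code) (x : List Bool × List Action) : Part (List Percept) :=
  Nat.rfindOpt (searchStep c x)

theorem mem_outputOf {c : Code} {x : List Bool × List Action} {e : List Percept} :
    e ∈ outputOf c x ↔ IsOutput c x e := by
  rw [← exists_mem_searchStep]
  exact mem_rfindOpt_iff fun h h' =>
    (exists_mem_searchStep.1 ⟨_, h⟩).unique (exists_mem_searchStep.1 ⟨_, h'⟩)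

theorem partrec_outputOf : Partrec₂ outputOf :=
  (Partrec.rfindOpt primrec_searchStep.to_comp : _)

theorem length_of_mem_outputOf {c : Code} {p : List Bool} {a : List Action} {e : List Percept}
    (h : e ∈ outputOf c (p, a)) : e.length = a.length := by
  obtain ⟨s, hs, hl, u, hu, hp, ha, rfl⟩ := mem_outputOf.1 h
  simpa [(hs u hu u hu _ hl).1] using ha.length_le

theorem outputOf_mono {c : Code} {p q : List Bool} {a : List Action} {e : List Percept}
    (hpq : p <+: q) (h : e ∈ outputOf c (p, a)) : e ∈ outputOf c (q, a) := by
  obtain ⟨s, hs, hl, u, hu, hp, ha, he⟩ := mem_outputOf.1 h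
  exact mem_outputOf.2 ⟨s, hs, hl, u, hu, hp.trans hpq, ha, he⟩

theorem outputOf_chronological {c : Code} {p : List Bool} {a b : List Action} {e : List Percept}
    (h : e ∈ outputOf c (p, a ++ b)) : e.take a.length ∈ outputOf c (p, a) := by
  obtain ⟨s, hs, hl, u, hu, hp, ha, rfl⟩ := mem_outputOf.1 h
  simp only [List.length_append] at hl
  refine mem_outputOf.2 ⟨s, hs, by dsimp only; omega, u, hu, hp,
    (List.prefix_append a b).trans ha, ?_⟩
  simp [List.take_take]

/-- Every monotone machine occurs in the enumeration. -/
theorem exists_outputOf_eq (T : MonotoneMachine) : ∃ c, outputOf c = T.run := by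
  obtain ⟨c, hc⟩ := Nat.Partrec.Code.exists_code.1 T.partrec
  have hgraph : ∀ u, (∃ s, u ∈ stageGraph c s) ↔ u.2 ∈ T.run u.1 := by
    intro u
    have h : ∀ m, m ∈ eval c (encode u.1) ↔ ∃ e ∈ T.run u.1, encode e = m := by
      intro m
      simp [hc]
    constructor
    · rintro ⟨s, hs⟩
      obtain ⟨m, hm, hd⟩ := mem_stageGraph_iff.1 hs
      obtain ⟨e, he, rfl⟩ := (h m).1 (Nat.Partrec.Code.evaln_sound hm)
      rw [Encodable.encodek, Option.some_inj] at hd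
      exact hd ▸ he
    · intro hu
      obtain ⟨s, hs⟩ := Nat.Partrec.Code.evaln_complete.1 ((h _).2 ⟨u.2, hu, rfl⟩)
      exact ⟨s, mem_stageGraph_iff.2 ⟨_, hs, Encodable.encodek _⟩⟩
  have hpre : ∀ {p a b e}, a <+: b → e ∈ T.run (p, b) → e.take a.length ∈ T.run (p, a) := by
    rintro p a _ e ⟨b, rfl⟩ he
    exact T.chronological p a b e he
  -- A genuine machine passes the test at every stage: by monotonicity and chronology both outputs
  -- restrict to the output on the longer program and the common first `l` actions.
  have hcons : ∀ s, Consistent c s := by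
    intro s u hu v hv l _
    have hu' := (hgraph u).1 ⟨s, hu⟩
    have hv' := (hgraph v).1 ⟨s, hv⟩
    have hlen := T.length_eq _ _ _ hu'
    have hlen' := T.length_eq _ _ _ hv'
    refine ⟨hlen, fun hp hl => ?_⟩
    have h₁ := hpre (List.take_prefix l u.1.2) (T.mono _ _ _ _ hp hu')
    have h₂ := hpre (List.take_prefix l v.1.2) hv'
    rw [hl] at h₁
    have := Part.mem_unique h₁ h₂
    have hmin : (List.take l v.1.2).length = (List.take l u.1.2).length := by rw [hl]
    rw [List.length_take, List.length_take] at hmin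
    rw [List.length_take] at this
    -- Outputs are as long as their action strings, so truncating at the length of the truncated
    -- action string is the same as truncating at `l`.
    have t₁ : u.2.take (min l v.1.2.length) = u.2.take l := by
      rw [hmin, ← hlen, List.take_eq_take_iff]; simp
    have t₂ : v.2.take (min l v.1.2.length) = v.2.take l := by
      rw [← hlen', List.take_eq_take_iff]; simp
    rwa [t₁, t₂] at this
  refine ⟨c, funext fun x => Part.ext fun e => ?_⟩
  rw [mem_outputOf]
  constructor
  · rintro ⟨s, -, -, u, hu, hp, ha, rfl⟩
    exact hpre ha (T.mono _ _ _ _ hp ((hgraph u).1 ⟨s, hu⟩))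
  · intro he
    obtain ⟨s, hs⟩ := (hgraph (x, e)).2 he
    refine ⟨max s (x.2.length + 1), hcons _, by omega, (x, e), stageGraph_mono (le_max_left _ _) hs,
      List.prefix_rfl, List.prefix_rfl, ?_⟩
    rw [← T.length_eq _ _ _ he, List.take_length]

/-! ## The dominant environment -/

theorem PrimrecRel.rePred_exists {α : Type} [Primcodable α] {R : α → ℕ → Prop}
    (hR : PrimrecRel R) : REPred fun a => ∃ n, R a n := by
  classical
  have h : Partrec fun a => Nat.rfindOpt fun n => if R a n then some () else none :=
    Partrec.rfindOpt (f := fun a n => if R a n then some () else none)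
      (Primrec.ite hR (Primrec.const (some ())) (Primrec.const none) : Primrec _).to_comp
  refine h.dom_re.of_eq fun a => ?_
  simp [Nat.rfindOpt_dom]

/-- The percepts of the dominant environment: the reward is `0` up to and including the step of the
first action `false`, and `1` afterwards. -/
def percepts (a : List Action) : List Percept :=
  (List.range a.length).map fun k => (false, decide (a.idxOf false < k))

/-- The action after the first action `false`. -/
def choice (a : List Action) : Option Action := a[a.idxOf false + 1]?

/-- The `k`-th value of the partial function that is encoded by `x`. -/
def query (s x k : ℕ) : Option ℕ :=
  evaln s (Denumerable.ofNat Code x.unpair.1) (Nat.pair x.unpair.2 k)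

/-- If the second branch was chosen, then the computations that it waits for stop in `s` steps. -/
def Halts (a : List Action) (s : ℕ) : Prop :=
  choice a = some true →
    ∀ k < a.length - (a.idxOf false + 1), query s (a.idxOf false) k ≠ none

/-- If the first branch was chosen, then the first random bit is `true`. -/
def CoinHeads (p : List Bool) (a : List Action) : Prop :=
  choice a = some false → p.head? = some true

theorem primrec_idxOf : Primrec fun a : List Action => a.idxOf false :=
  Primrec.list_idxOf.comp (Primrec.const false) Primrec.id

theorem primrec_percepts : Primrec percepts :=
  Primrec.list_map (Primrec.list_range.comp Primrec.list_length)
    ((Primrec.const false).pair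
      (Primrec.nat_lt.comp (primrec_idxOf.comp Primrec.fst) Primrec.snd).decide)

theorem primrec_choice : Primrec choice :=
  Primrec.list_getElem?.comp Primrec.id (Primrec.succ.comp primrec_idxOf)

theorem primrecRel_halts : PrimrecRel Halts := by
  have hq : PrimrecRel fun (k : ℕ) (y : ℕ × ℕ) => query y.1 y.2 k ≠ none := by
    refine (Primrec.eq.comp (Nat.Partrec.Code.primrec_evaln.comp
      (((Primrec.fst.comp Primrec.snd).pair ((Primrec.ofNat Code).comp
        (Primrec.fst.comp (Primrec.unpair.comp (Primrec.snd.comp Primrec.snd))))).pair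
        (Primrec₂.natPair.comp
          (Primrec.snd.comp (Primrec.unpair.comp (Primrec.snd.comp Primrec.snd)))
          Primrec.fst))) (Primrec.const none)).not
  have i : Primrec fun x : List Action × ℕ => x.1.idxOf false := primrec_idxOf.comp Primrec.fst
  refine ((Primrec.eq.comp (primrec_choice.comp Primrec.fst) (Primrec.const (some true))).not.or
    (hq.forall_mem_list.comp (Primrec.list_range.comp (Primrec.nat_sub.comp
      (Primrec.list_length.comp Primrec.fst) (Primrec.succ.comp i)))
      (Primrec.snd.pair i))).of_eq fun x => ?_
  simp only [Halts, List.mem_range, imp_iff_not_or, Nat.succ_eq_add_one]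

theorem primrecRel_coinHeads : PrimrecRel CoinHeads :=
  ((Primrec.eq.comp (primrec_choice.comp Primrec.snd) (Primrec.const (some false))).not.or
    (Primrec.eq.comp (Primrec.list_head?.comp Primrec.fst) (Primrec.const (some true)))).of_eq
    fun x => by simp only [CoinHeads, imp_iff_not_or]

theorem percepts_append (a b : List Action) :
    (percepts (a ++ b)).take a.length = percepts a := by
  apply List.ext_getElem?
  intro k
  by_cases hk : k < a.length
  · by_cases hf : false ∈ a
    · simp [percepts, hk, List.idxOf_append_of_mem hf]
    -- Without `false` in `a`, the first `false` of `a ++ b` has index at least `a.length`, so the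
    -- first `a.length` rewards are 0 on both sides.
    · simp only [percepts, List.getElem?_take, hk, List.idxOf_append_of_notMem hf,
        List.getElem?_map, List.length_append, if_true]
      rw [List.getElem?_range (by omega), List.getElem?_range hk, List.idxOf_eq_length hf]
      simp
      omega
  · simp [percepts, hk]

/-- Later actions cannot change a choice once made. Hence `Halts` and `CoinHeads` pass to prefixes,
which is what makes the dominant machine chronological. -/
theorem choice_append {a b : List Action} {c : Action} (h : choice a = some c) :
    choice (a ++ b) = some c ∧ (a ++ b).idxOf false = a.idxOf false := by
  have hl := (List.getElem?_eq_some_iff.1 h).1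
  have hf : false ∈ a := List.idxOf_lt_length_iff.1 (by omega)
  rw [choice, List.idxOf_append_of_mem hf, List.getElem?_append_left hl]
  exact ⟨h, rfl⟩

theorem Halts.of_append {a b : List Action} {s : ℕ} (h : Halts (a ++ b) s) : Halts a s := by
  intro hc k hk
  obtain ⟨h₁, h₂⟩ := choice_append (b := b) hc
  have := h h₁ k (by rw [h₂, List.length_append]; omega)
  rwa [h₂] at this

theorem CoinHeads.of_append {p : List Bool} {a b : List Action} (h : CoinHeads p (a ++ b)) :
    CoinHeads p a :=
  fun hc => h (choice_append hc).1

theorem CoinHeads.mono {p q : List Bool} {a : List Action} (hpq : p <+: q) (h : CoinHeads p a) :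
    CoinHeads q a := by
  intro hc
  obtain ⟨r, rfl⟩ := hpq
  simp [List.head?_append, h hc]

open Classical in
/-- The partial function computed by the machine of the dominant environment. -/
def dominantRun (x : List Bool × List Action) : Part (List Percept) :=
  Nat.rfindOpt fun s => if CoinHeads x.1 x.2 ∧ Halts x.2 s then some (percepts x.2) else none

open Classical in
theorem mem_dominantRun {p : List Bool} {a : List Action} {e : List Percept} :
    e ∈ dominantRun (p, a) ↔ e = percepts a ∧ CoinHeads p a ∧ ∃ s, Halts a s := by
  have h : ∀ {s e}, (e ∈ if CoinHeads p a ∧ Halts a s then some (percepts a) else none) ↔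
      e = percepts a ∧ CoinHeads p a ∧ Halts a s := by
    intro s e
    split_ifs with hc <;> simp [hc, eq_comm]
  refine (mem_rfindOpt_iff fun h₁ h₂ => (h.1 h₁).1.trans (h.1 h₂).1.symm).trans ?_
  simp only [h, exists_and_left]

open Classical in
/-- The machine of the dominant environment. -/
def dominantMachine : MonotoneMachine where
  run := dominantRun
  partrec := Partrec.rfindOpt
    (f := fun (x : List Bool × List Action) s =>
      if CoinHeads x.1 x.2 ∧ Halts x.2 s then some (percepts x.2) else none)
    (Primrec.ite (c := fun y : (List Bool × List Action) × ℕ =>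
        CoinHeads y.1.1 y.1.2 ∧ Halts y.1.2 y.2)
      ((primrecRel_coinHeads.comp (Primrec.fst.comp Primrec.fst)
        (Primrec.snd.comp Primrec.fst)).and
        (primrecRel_halts.comp (Primrec.snd.comp Primrec.fst) Primrec.snd))
      (Primrec.option_some.comp (primrec_percepts.comp (Primrec.snd.comp Primrec.fst)))
      (Primrec.const none) : Primrec _).to_comp
  length_eq p a e h := by simp [(mem_dominantRun.1 h).1, percepts]
  mono p q a e hpq h := by
    rw [mem_dominantRun] at h ⊢
    exact ⟨h.1, h.2.1.mono hpq, h.2.2⟩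
  chronological p a b e h := by
    rw [mem_dominantRun] at h ⊢
    exact ⟨by rw [h.1, percepts_append], h.2.1.of_append, h.2.2.imp fun _ => Halts.of_append⟩

/-- The dominant environment. -/
def dominant : History → ℝ := dominantMachine.outputProb

instance : IsProbabilityMeasure coinFlips :=
  inferInstanceAs (IsProbabilityMeasure (Measure.infinitePi _))

theorem coinFlips_real_head : coinFlips.real {ω | ω 0 = true} = 1 / 2 := by
  have h := measurePreserving_eval_infinitePi
    (fun _ : ℕ => (PMF.uniformOfFintype Bool).toMeasure) 0
  have h' := h.measure_preimage (MeasurableSet.singleton true).nullMeasurableSet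
  rw [measureReal_def]
  have he : (Function.eval 0 ⁻¹' {true} : Set (ℕ → Bool)) = {ω | ω 0 = true} := by
    ext; simp
  rw [he] at h'
  rw [coinFlips, h', PMF.toMeasure_apply_singleton _ _ (MeasurableSet.singleton true)]
  simp

/-- The condition under which the dominant environment can output the percepts of `h`. -/
def Possible (h : History) : Prop :=
  h.map Prod.snd = percepts (h.map Prod.fst) ∧ ∃ s, Halts (h.map Prod.fst) s

theorem dominant_eq_zero {h : History} (hh : ¬ Possible h) : dominant h = 0 := by
  have : {ω : ℕ → Bool | ∃ n : ℕ, h.map Prod.snd ∈ dominantMachine.run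
      (List.ofFn (fun i : Fin n => ω i), h.map Prod.fst)} = ∅ := by
    refine Set.eq_empty_of_forall_notMem fun ω ⟨n, hn⟩ => hh ?_
    have := mem_dominantRun.1 hn
    exact ⟨this.1, this.2.2⟩
  rw [dominant, MonotoneMachine.outputProb, this, measureReal_empty]

theorem dominant_eq_half {h : History} (hh : Possible h)
    (hc : choice (h.map Prod.fst) = some false) : dominant h = 1 / 2 := by
  have : {ω : ℕ → Bool | ∃ n : ℕ, h.map Prod.snd ∈ dominantMachine.run
      (List.ofFn (fun i : Fin n => ω i), h.map Prod.fst)} = {ω | ω 0 = true} := by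
    ext ω
    constructor
    · rintro ⟨n, hn⟩
      have := (mem_dominantRun.1 hn).2.1 hc
      cases n with
      | zero => simp at this
      | succ n => simpa using this
    · intro hω
      exact ⟨1, mem_dominantRun.2 ⟨hh.1, fun _ => by simpa using hω, hh.2⟩⟩
  rw [dominant, MonotoneMachine.outputProb, this, coinFlips_real_head]

theorem dominant_eq_one {h : History} (hh : Possible h)
    (hc : choice (h.map Prod.fst) ≠ some false) : dominant h = 1 := by
  have : {ω : ℕ → Bool | ∃ n : ℕ, h.map Prod.snd ∈ dominantMachine.run
      (List.ofFn (fun i : Fin n => ω i), h.map Prod.fst)} = Set.univ :=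
    Set.eq_univ_of_forall fun ω => ⟨0, mem_dominantRun.2 ⟨hh.1, fun h => absurd h hc, hh.2⟩⟩
  rw [dominant, MonotoneMachine.outputProb, this, probReal_univ]

theorem dominant_append_le (h g : History) : dominant (h ++ g) ≤ dominant h := by
  refine measureReal_mono fun ω ⟨n, hn⟩ => ⟨n, ?_⟩
  rw [List.map_append, List.map_append] at hn
  have := dominantMachine.chronological _ _ _ _ hn
  simpa using this

/-- The actions determine the percepts, so the semimeasure inequality for `dominant` reduces to a
single term. -/
theorem possible_append_singleton {h : History} {a : Action} {e : Percept}
    (hh : Possible (h ++ [(a, e)])) :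
    e = (false, decide ((h.map Prod.fst ++ [a]).idxOf false < h.length)) := by
  have h₁ := congrArg (·[h.length]?) hh.1
  simpa [percepts] using h₁

theorem ratOf_lt_iff (q : ℕ × ℕ × ℕ) (r : ℝ) :
    (ratOf q : ℝ) < r ↔ (q.1 : ℝ) < r * (q.2.2 + 1) + q.2.1 := by
  have h : (0 : ℝ) < q.2.2 + 1 := by positivity
  rw [ratOf]
  push_cast
  rw [div_lt_iff₀ h, sub_lt_iff_lt_add]

theorem ratOf_lt_zero (q : ℕ × ℕ × ℕ) : (ratOf q : ℝ) < 0 ↔ q.1 < q.2.1 := by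
  rw [ratOf_lt_iff, zero_mul, zero_add, Nat.cast_lt]

theorem ratOf_lt_half (q : ℕ × ℕ × ℕ) :
    (ratOf q : ℝ) < 1 / 2 ↔ q.1 + q.1 < q.2.2 + 1 + (q.2.1 + q.2.1) := by
  rw [ratOf_lt_iff, ← Nat.cast_lt (α := ℝ)]
  push_cast
  constructor <;> intro h <;> linarith

theorem ratOf_lt_one (q : ℕ × ℕ × ℕ) : (ratOf q : ℝ) < 1 ↔ q.1 < q.2.2 + 1 + q.2.1 := by
  rw [ratOf_lt_iff, one_mul]
  exact_mod_cast Iff.rfl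

/-- The only values are 0, 1/2 and 1. Being nonzero is semidecidable by searching for a stage `s`,
and `choice` decides between 1/2 and 1; with denominators cleared, the comparisons with `q` are
between natural numbers. -/
theorem lowerSemicomputable_dominant : LowerSemicomputable dominant := by
  have hR : PrimrecRel fun (x : History × ℕ × ℕ × ℕ) (s : ℕ) =>
      x.2.1 < x.2.2.1 ∨ ((x.1.map Prod.snd = percepts (x.1.map Prod.fst) ∧
        Halts (x.1.map Prod.fst) s) ∧ (x.2.1 + x.2.1 < x.2.2.2 + 1 + (x.2.2.1 + x.2.2.1) ∨
          (x.2.1 < x.2.2.2 + 1 + x.2.2.1 ∧ choice (x.1.map Prod.fst) ≠ some false))) := by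
    have hm : Primrec fun x : (History × ℕ × ℕ × ℕ) × ℕ => x.1.2.1 :=
      Primrec.fst.comp (Primrec.snd.comp Primrec.fst)
    have hn : Primrec fun x : (History × ℕ × ℕ × ℕ) × ℕ => x.1.2.2.1 :=
      Primrec.fst.comp (Primrec.snd.comp (Primrec.snd.comp Primrec.fst))
    have hd : Primrec fun x : (History × ℕ × ℕ × ℕ) × ℕ => x.1.2.2.2 + 1 :=
      Primrec.succ.comp (Primrec.snd.comp (Primrec.snd.comp (Primrec.snd.comp Primrec.fst)))
    have ha : Primrec fun x : (History × ℕ × ℕ × ℕ) × ℕ => x.1.1.map Prod.fst :=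
      Primrec.list_map (Primrec.fst.comp Primrec.fst) (Primrec.fst.comp Primrec.snd)
    have he : Primrec fun x : (History × ℕ × ℕ × ℕ) × ℕ => x.1.1.map Prod.snd :=
      Primrec.list_map (Primrec.fst.comp Primrec.fst) (Primrec.snd.comp Primrec.snd)
    exact (Primrec.nat_lt.comp hm hn).or (((Primrec.eq.comp he (primrec_percepts.comp ha)).and
      (primrecRel_halts.comp ha Primrec.snd)).and ((Primrec.nat_lt.comp
        (Primrec.nat_add.comp hm hm) (Primrec.nat_add.comp hd (Primrec.nat_add.comp hn hn))).or
        ((Primrec.nat_lt.comp hm (Primrec.nat_add.comp hd hn)).and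
          (Primrec.eq.comp (primrec_choice.comp ha) (Primrec.const (some false))).not)))
  refine (PrimrecRel.rePred_exists hR).of_eq fun x => ?_
  obtain ⟨h, q⟩ := x
  simp only [← ratOf_lt_zero, ← ratOf_lt_half, ← ratOf_lt_one]
  by_cases hP : Possible h
  · by_cases hc : choice (h.map Prod.fst) = some false
    · rw [dominant_eq_half hP hc]
      constructor
      · rintro ⟨s, hs | ⟨-, hs | hs⟩⟩
        · linarith
        · exact hs
        · exact absurd hc hs.2
      · intro hq
        obtain ⟨h₁, s, hs⟩ := hP
        exact ⟨s, Or.inr ⟨⟨h₁, hs⟩, Or.inl hq⟩⟩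
    · rw [dominant_eq_one hP hc]
      constructor
      · rintro ⟨s, hs | ⟨-, hs | hs⟩⟩
        · linarith
        · linarith
        · exact hs.1
      · intro hq
        obtain ⟨h₁, s, hs⟩ := hP
        exact ⟨s, Or.inr ⟨⟨h₁, hs⟩, Or.inr ⟨hq, hc⟩⟩⟩
  · rw [dominant_eq_zero hP]
    constructor
    · rintro ⟨s, hs | ⟨hs, -⟩⟩
      · exact hs
      · exact absurd ⟨hs.1, s, hs.2⟩ hP
    · exact fun hq => ⟨0, Or.inl hq⟩

theorem isLSCCCS_dominant : IsLSCCCS dominant where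
  nonneg _ := measureReal_nonneg
  nil_le_one := measureReal_le_one
  sum_le h a := by
    rw [Finset.sum_eq_single
      (false, decide ((h.map Prod.fst ++ [a]).idxOf false < h.length))]
    · exact dominant_append_le _ _
    · exact fun e _ he => dominant_eq_zero fun hP => he (possible_append_singleton hP)
    · simp
  lowerSemicomputable := lowerSemicomputable_dominant

/-! ## A universal machine with a dominant environment -/

/-- The codes of the simulated machines; the first five are those of the dominant environment. -/
def indexCode (i : ℕ) : Code :=
  if i < 5 then (exists_outputOf_eq dominantMachine).choose else Denumerable.ofNat Code (i - 5)

theorem outputOf_indexCode {i : ℕ} (hi : i < 5) : outputOf (indexCode i) = dominantMachine.run := by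
  rw [indexCode, if_pos hi]
  exact (exists_outputOf_eq dominantMachine).choose_spec

/-- The code obtained by choice for the indices below 5 is one fixed value, so it enters as a
constant. -/
theorem computable_indexCode : Computable indexCode :=
  (Primrec.ite (Primrec.nat_lt.comp Primrec.id (Primrec.const 5)) (Primrec.const _)
    ((Primrec.ofNat Code).comp (Primrec.nat_sub.comp Primrec.id (Primrec.const 5)))).to_comp

/-- The code word `0 ^ i 1`. -/
def codeWord (i : ℕ) : List Bool := List.replicate i false ++ [true]

theorem length_codeWord (i : ℕ) : (codeWord i).length = i + 1 := by simp [codeWord]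

theorem idxOf_codeWord_append (i : ℕ) (p : List Bool) : (codeWord i ++ p).idxOf true = i := by
  induction i with
  | zero => simp [codeWord]
  | succ i ih =>
    simp only [codeWord, List.replicate_succ, List.cons_append, List.append_assoc] at ih ⊢
    rw [List.idxOf_cons_ne _ (by decide), ih]

theorem drop_codeWord_append (i : ℕ) (p : List Bool) : (codeWord i ++ p).drop (i + 1) = p :=
  List.drop_left' (length_codeWord i)

theorem codeWord_append_drop {p : List Bool} (hp : true ∈ p) :
    codeWord (p.idxOf true) ++ p.drop (p.idxOf true + 1) = p := by
  induction p with
  | nil => simp at hp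
  | cons b p ih =>
    cases b with
    | true => simp [codeWord]
    | false =>
      have := ih (by simpa using hp)
      rw [List.idxOf_cons_ne _ (by decide)]
      simpa [codeWord, List.replicate_succ] using this

theorem computable_codeWord : Computable codeWord :=
  ((Primrec.list_append.comp (Primrec.list_map Primrec.list_range (Primrec.const false).to₂)
    (Primrec.const [true])).of_eq fun i => by
      simp [codeWord, List.map_const']).to_comp

/-- The partial function computed by the universal machine. -/
def universalRun (x : List Bool × List Action) : Part (List Percept) :=
  bif decide (x.1.idxOf true < x.1.length) then
    outputOf (indexCode (x.1.idxOf true)) (x.1.drop (x.1.idxOf true + 1), x.2)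
  else Part.none

theorem mem_universalRun {p : List Bool} {a : List Action} {e : List Percept} :
    e ∈ universalRun (p, a) ↔ ∃ i q, p = codeWord i ++ q ∧ e ∈ outputOf (indexCode i) (q, a) := by
  constructor
  · intro h
    by_cases hp : true ∈ p
    · rw [universalRun, decide_eq_true (List.idxOf_lt_length_iff.2 hp)] at h
      exact ⟨_, _, (codeWord_append_drop hp).symm, h⟩
    · rw [universalRun, decide_eq_false (mt List.idxOf_lt_length_iff.1 hp)] at h
      exact absurd h (Part.notMem_none _)
  · rintro ⟨i, q, rfl, h⟩
    have : i < (codeWord i ++ q).length := by rw [List.length_append, length_codeWord]; omega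
    simp only [universalRun, idxOf_codeWord_append, drop_codeWord_append]
    rwa [decide_eq_true this]

theorem universalRun_codeWord (i : ℕ) (p : List Bool) (a : List Action) :
    universalRun (codeWord i ++ p, a) = outputOf (indexCode i) (p, a) := by
  have : i < (codeWord i ++ p).length := by rw [List.length_append, length_codeWord]; omega
  simp only [universalRun, idxOf_codeWord_append, drop_codeWord_append]
  rw [decide_eq_true this, cond_true]

theorem partrec_universalRun : Partrec universalRun := by
  have i : Primrec fun x : List Bool × List Action => x.1.idxOf true :=
    Primrec.list_idxOf.comp (Primrec.const true) Primrec.fst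
  refine Partrec.cond
    (Primrec.nat_lt.comp i (Primrec.list_length.comp Primrec.fst)).decide.to_comp
    (partrec_outputOf.comp (computable_indexCode.comp i.to_comp)
      ((Primrec.list_drop.comp (Primrec.succ.comp i) Primrec.fst).pair Primrec.snd).to_comp)
    Partrec.none

/-- A universal machine in whose mixture one environment dominates all others. -/
def universalMachine : UniversalMachine where
  run := universalRun
  partrec := partrec_universalRun
  length_eq p a e h := by
    obtain ⟨i, q, -, h⟩ := mem_universalRun.1 h
    exact length_of_mem_outputOf h
  mono p q a e hpq h := by
    obtain ⟨i, s, rfl, hs⟩ := mem_universalRun.1 h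
    obtain ⟨r, rfl⟩ := hpq
    exact mem_universalRun.2 ⟨i, s ++ r, List.append_assoc _ _ _,
      outputOf_mono (List.prefix_append s r) hs⟩
  chronological p a b e h := by
    obtain ⟨i, q, hp, h⟩ := mem_universalRun.1 h
    exact mem_universalRun.2 ⟨i, q, hp, outputOf_chronological h⟩
  code := codeWord
  code_computable := computable_codeWord
  code_prefixFree i j h := by
    obtain ⟨r, hr⟩ := h
    have := congrArg (List.idxOf true) hr
    rw [idxOf_codeWord_append, ← List.append_nil (codeWord j), idxOf_codeWord_append] at this
    exact this
  simulates T := by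
    obtain ⟨c, hc⟩ := exists_outputOf_eq T
    -- The offset skips the indices reserved for the dominant machine.
    refine ⟨encode c + 5, fun p a => ?_⟩
    rw [universalRun_codeWord, indexCode, if_neg (by omega), Nat.add_sub_cancel,
      Denumerable.ofNat_encode, hc]
  code_of_output p a e h := by
    obtain ⟨i, q, rfl, -⟩ := mem_universalRun.1 h
    exact ⟨i, List.prefix_append _ _⟩

theorem machine_eq_dominantMachine {i : ℕ} (hi : i < 5) :
    (universalMachine.machine i).outputProb = dominant := by
  have : (universalMachine.machine i).run = dominantMachine.run := by
    funext x
    exact (universalRun_codeWord i x.1 x.2).trans (congrFun (outputOf_indexCode hi) x)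
  funext h
  simp only [dominant, MonotoneMachine.outputProb, this]

/-! ## Mixtures of semimeasures -/

/-- Chronological conditional semimeasures. -/
structure IsSemimeasure (ν : History → ℝ) : Prop where
  nonneg : ∀ h, 0 ≤ ν h
  sum_le : ∀ (h : History) (a : Action), ∑ e : Percept, ν (h ++ [(a, e)]) ≤ ν h

theorem IsLSCCCS.isSemimeasure {ν : History → ℝ} (h : IsLSCCCS ν) : IsSemimeasure ν :=
  ⟨h.nonneg, h.sum_le⟩

theorem IsSemimeasure.le_nil {ν : History → ℝ} (hν : IsSemimeasure ν) (h : History) :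
    ν h ≤ ν [] := by
  induction h using List.reverseRecOn with
  | nil => exact le_rfl
  | append_singleton h x ih =>
    exact ((Finset.single_le_sum (f := fun e => ν (h ++ [(x.1, e)])) (fun e _ => hν.nonneg _)
      (Finset.mem_univ x.2)).trans (hν.sum_le h x.1)).trans ih

/-- The mixture of all environments with weights `u`. -/
def mix (u : EnvClass → ℝ) (h : History) : ℝ := ∑' ν : EnvClass, u ν * ν.1 h

theorem summable_mix {u : EnvClass → ℝ} (hu : ∀ ν, 0 ≤ u ν) (hs : Summable u) (h : History) :
    Summable fun ν : EnvClass => u ν * ν.1 h :=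
  hs.of_nonneg_of_le (fun ν => mul_nonneg (hu ν) (ν.2.nonneg h)) fun ν =>
    mul_le_of_le_one_right (hu ν) ((ν.2.isSemimeasure.le_nil h).trans ν.2.nil_le_one)

theorem mix_le_tsum {u : EnvClass → ℝ} (hu : ∀ ν, 0 ≤ u ν) (hs : Summable u) (h : History) :
    mix u h ≤ ∑' ν, u ν :=
  (summable_mix hu hs h).tsum_le_tsum (fun ν =>
    mul_le_of_le_one_right (hu ν) ((ν.2.isSemimeasure.le_nil h).trans ν.2.nil_le_one)) hs

theorem isSemimeasure_mix {u : EnvClass → ℝ} (hu : ∀ ν, 0 ≤ u ν) (hs : Summable u) :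
    IsSemimeasure (mix u) where
  nonneg h := tsum_nonneg fun ν => mul_nonneg (hu ν) (ν.2.nonneg h)
  sum_le h a := by
    simp only [mix]
    rw [← Summable.tsum_finsetSum fun e _ => summable_mix hu hs _]
    refine (summable_sum fun e _ => summable_mix hu hs _).tsum_le_tsum (fun ν => ?_)
      (summable_mix hu hs h)
    rw [← Finset.mul_sum]
    exact mul_le_mul_of_nonneg_left (ν.2.sum_le h a) (hu ν)

theorem hasSum_codeWord : HasSum (fun i => (1 / 2 : ℝ) ^ (codeWord i).length) 1 := by
  simp only [length_codeWord]
  have := hasSum_geometric_two.mul_right (1 / 2 : ℝ)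
  simpa [pow_succ] using this

theorem prior_nonneg (ν : EnvClass) : 0 ≤ universalMachine.prior ν :=
  tsum_nonneg fun _ => by positivity

/-- An index determines the environment it computes, so the pairs of an environment and one of its
indices inject into `ℕ`, and the total weight is part of the sum of `2 ^ (-(i + 1))`. -/
theorem summable_prior_and_tsum_le :
    Summable universalMachine.prior ∧ ∑' ν, universalMachine.prior ν ≤ 1 := by
  let g : (Σ ν : EnvClass, {i : ℕ // (universalMachine.machine i).outputProb = ν.1}) → ℕ :=
    fun x => x.2.1
  have hg : Function.Injective g := by
    rintro ⟨ν, i, hi⟩ ⟨ν', i', hi'⟩ (rfl : i = i')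
    obtain rfl : ν = ν' := Subtype.ext (hi.symm.trans hi')
    rfl
  have hs : Summable fun x => (1 / 2 : ℝ) ^ (codeWord (g x)).length :=
    hasSum_codeWord.summable.comp_injective hg
  refine ⟨hs.sigma, ?_⟩
  calc ∑' ν, universalMachine.prior ν = ∑' x, (1 / 2 : ℝ) ^ (codeWord (g x)).length :=
        hs.tsum_sigma.symm
    _ ≤ ∑' i, (1 / 2 : ℝ) ^ (codeWord i).length :=
        tsum_comp_le_tsum_of_inj hasSum_codeWord.summable (fun _ => by positivity) hg
    _ = 1 := hasSum_codeWord.tsum_eq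

/-- The reserved indices contribute 1/2 + 1/4 + 1/8 + 1/16 + 1/32 = 31/32; further indices computing
the same environment can only add weight. -/
theorem le_prior_dominant : 31 / 32 ≤ universalMachine.prior ⟨dominant, isLSCCCS_dominant⟩ := by
  have h : universalMachine.prior ⟨dominant, isLSCCCS_dominant⟩ =
      ∑' i, Set.indicator {i | (universalMachine.machine i).outputProb = dominant}
        (fun i => (1 / 2 : ℝ) ^ (codeWord i).length) i :=
    tsum_subtype {i | (universalMachine.machine i).outputProb = dominant}
      fun i => (1 / 2 : ℝ) ^ (codeWord i).length
  rw [h]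
  refine le_trans (le_of_eq ?_) ((hasSum_codeWord.summable.indicator _).sum_le_tsum
    (Finset.range 5) fun i _ => Set.indicator_nonneg (fun _ _ => by positivity) i)
  rw [Finset.sum_congr rfl fun i hi => Set.indicator_of_mem
    (s := {i | (universalMachine.machine i).outputProb = dominant})
    (machine_eq_dominantMachine (Finset.mem_range.1 hi)) _]
  simp only [length_codeWord, Finset.sum_range_succ, Finset.sum_range_zero]
  norm_num

/-- The mixture consists of the dominant environment and a small semimeasure. -/
theorem exists_mixture_eq : ∃ (w : ℝ) (ν : History → ℝ), 31 / 32 ≤ w ∧ IsSemimeasure ν ∧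
    (∀ h, w + ν h ≤ 1) ∧ ∀ h, universalMachine.mixture h = w * dominant h + ν h := by
  classical
  obtain ⟨hs, hle⟩ := summable_prior_and_tsum_le
  let ρ : EnvClass := ⟨dominant, isLSCCCS_dominant⟩
  let u : EnvClass → ℝ := fun ν => if ν = ρ then 0 else universalMachine.prior ν
  have hu : ∀ ν, 0 ≤ u ν := fun ν => by
    dsimp only [u]
    split_ifs
    exacts [le_rfl, prior_nonneg ν]
  have hus : Summable u := hs.of_nonneg_of_le hu fun ν => by
    dsimp only [u]
    split_ifs
    exacts [prior_nonneg ν, le_rfl]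
  refine ⟨universalMachine.prior ρ, mix u, le_prior_dominant, isSemimeasure_mix hu hus,
    fun h => ?_, fun h => ?_⟩
  · rw [hs.tsum_eq_add_tsum_ite ρ] at hle
    exact (add_le_add_right (mix_le_tsum hu hus h) _).trans hle
  · rw [UniversalMachine.mixture, (summable_mix prior_nonneg hs h).tsum_eq_add_tsum_ite ρ]
    congr 1
    exact tsum_congr fun ν => by simp only [u, ite_mul, zero_mul]

/-! ## Values in semimeasures -/

/-- The expected discounted reward of the first `n` steps, without normalizations. -/
def rewardSum (γ : ℕ → ℝ) (ν : History → ℝ) (π : Policy) (h : History) (n : ℕ) : ℝ :=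
  ∑ e : Fin n → Percept,
    (∑ k : Fin n, γ (h.length + 1 + k) * reward (e k)) * ν (follow π h (List.ofFn e))

theorem reward_nonneg (e : Percept) : 0 ≤ reward e := by
  unfold reward; split_ifs <;> norm_num

theorem reward_le_one (e : Percept) : reward e ≤ 1 := by
  unfold reward; split_ifs <;> norm_num

theorem follow_append_singleton (π : Policy) (h : History) (es : List Percept) (e : Percept) :
    follow π h (es ++ [e]) = follow π h es ++ [(π (follow π h es), e)] := by
  induction es generalizing h with
  | nil => rfl
  | cons x es ih => exact ih _

theorem exists_follow_eq (π : Policy) (h : History) (es : List Percept) :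
    ∃ g, follow π h es = h ++ g ∧ g.map Prod.snd = es := by
  induction es generalizing h with
  | nil => exact ⟨[], by simp [follow]⟩
  | cons x es ih =>
    obtain ⟨g, hg, hs⟩ := ih (h ++ [(π h, x)])
    exact ⟨(π h, x) :: g, by rw [follow, hg]; simp, by simp [hs]⟩

theorem sum_fin_succ_percept {n : ℕ} (F : (Fin (n + 1) → Percept) → ℝ) :
    ∑ e, F e = ∑ e : Fin n → Percept, ∑ x : Percept, F (Fin.snoc (α := fun _ => Percept) e x) := by
  rw [← (Fin.snocEquiv fun _ : Fin (n + 1) => Percept).sum_comp, Fintype.sum_prod_type_right]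
  rfl

theorem ofFn_snoc {n : ℕ} (e : Fin n → Percept) (x : Percept) :
    List.ofFn (Fin.snoc (α := fun _ => Percept) e x) = List.ofFn e ++ [x] := by
  rw [List.ofFn_succ']
  simp

section
variable {γ : ℕ → ℝ} {ν : History → ℝ}

theorem IsSemimeasure.sum_follow_le (hν : IsSemimeasure ν) (π : Policy) (h : History) (n : ℕ) :
    ∑ e : Fin n → Percept, ν (follow π h (List.ofFn e)) ≤ ν h := by
  induction n with
  | zero => simp [follow]
  | succ n ih =>
    rw [sum_fin_succ_percept]
    simp only [ofFn_snoc, follow_append_singleton]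
    exact (Finset.sum_le_sum fun e _ => hν.sum_le _ _).trans ih

theorem IsDiscount.summable_tail (hγ : IsDiscount γ) (t : ℕ) : Summable fun i => γ (t + i) :=
  hγ.summable.comp_injective (add_right_injective t)

theorem IsDiscount.sum_le_tailSum (hγ : IsDiscount γ) (t n : ℕ) :
    ∑ k : Fin n, γ (t + k) ≤ tailSum γ t := by
  rw [Fin.sum_univ_eq_sum_range fun k => γ (t + k)]
  exact (hγ.summable_tail t).sum_le_tsum _ fun _ _ => hγ.nonneg _

theorem IsDiscount.tendsto_sum (hγ : IsDiscount γ) (t : ℕ) :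
    Tendsto (fun n => ∑ k : Fin n, γ (t + k)) atTop (nhds (tailSum γ t)) := by
  simp only [fun n => Fin.sum_univ_eq_sum_range (fun k => γ (t + k)) n]
  exact (hγ.summable_tail t).hasSum.tendsto_sum_nat

theorem rewardSum_nonneg (hγ : IsDiscount γ) (hν : IsSemimeasure ν) (π : Policy) (h : History)
    (n : ℕ) : 0 ≤ rewardSum γ ν π h n :=
  Finset.sum_nonneg fun _ _ => mul_nonneg (Finset.sum_nonneg fun _ _ =>
    mul_nonneg (hγ.nonneg _) (reward_nonneg _)) (hν.nonneg _)

theorem rewardSum_le (hγ : IsDiscount γ) (hν : IsSemimeasure ν) (π : Policy) (h : History)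
    (n : ℕ) : rewardSum γ ν π h n ≤ tailSum γ (h.length + 1) * ν h := by
  calc rewardSum γ ν π h n ≤ ∑ e : Fin n → Percept,
        tailSum γ (h.length + 1) * ν (follow π h (List.ofFn e)) := by
        refine Finset.sum_le_sum fun e _ => mul_le_mul_of_nonneg_right ?_ (hν.nonneg _)
        exact (Finset.sum_le_sum fun k _ => mul_le_of_le_one_right (hγ.nonneg _)
          (reward_le_one _)).trans (hγ.sum_le_tailSum _ n)
    _ ≤ _ := by
        rw [← Finset.mul_sum]
        exact mul_le_mul_of_nonneg_left (hν.sum_follow_le π h n) (hγ.tailSum_pos _).le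

/-- One more step adds at most its discount times the initial mass, while the old rewards can only
lose mass. -/
theorem rewardSum_succ_le (hγ : IsDiscount γ) (hν : IsSemimeasure ν) (π : Policy) (h : History)
    (n : ℕ) : rewardSum γ ν π h (n + 1) ≤ rewardSum γ ν π h n + γ (h.length + 1 + n) * ν h := by
  have hstep : rewardSum γ ν π h (n + 1) ≤ ∑ e : Fin n → Percept,
      ((∑ k : Fin n, γ (h.length + 1 + k) * reward (e k)) + γ (h.length + 1 + n)) *
        ν (follow π h (List.ofFn e)) := by
    rw [rewardSum, sum_fin_succ_percept]
    refine Finset.sum_le_sum fun e _ => ?_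
    have hc : 0 ≤ (∑ k : Fin n, γ (h.length + 1 + k) * reward (e k)) + γ (h.length + 1 + n) :=
      add_nonneg (Finset.sum_nonneg fun _ _ => mul_nonneg (hγ.nonneg _) (reward_nonneg _))
        (hγ.nonneg _)
    refine le_trans ?_ (mul_le_mul_of_nonneg_left
      (hν.sum_le (follow π h (List.ofFn e)) (π (follow π h (List.ofFn e)))) hc)
    rw [Finset.mul_sum]
    refine Finset.sum_le_sum fun x _ => ?_
    rw [ofFn_snoc, follow_append_singleton]
    refine mul_le_mul_of_nonneg_right ?_ (hν.nonneg _)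
    rw [Fin.sum_univ_castSucc]
    simp only [Fin.snoc_castSucc, Fin.snoc_last, Fin.val_castSucc, Fin.val_last]
    gcongr
    exact mul_le_of_le_one_right (hγ.nonneg _) (reward_le_one _)
  refine hstep.trans ?_
  simp only [add_mul, Finset.sum_add_distrib, ← Finset.mul_sum]
  exact add_le_add le_rfl (mul_le_mul_of_nonneg_left (hν.sum_follow_le π h n) (hγ.nonneg _))

/-- The sums need not be monotone, since lost mass removes earlier rewards. Subtracting the largest
possible gain, the partial discount sum times `ν h`, leaves an antitone sequence bounded below. -/
theorem exists_tendsto_rewardSum (hγ : IsDiscount γ) (hν : IsSemimeasure ν) (π : Policy)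
    (h : History) : ∃ L, Tendsto (rewardSum γ ν π h) atTop (nhds L) := by
  have hanti : Antitone fun n => rewardSum γ ν π h n -
      (∑ k : Fin n, γ (h.length + 1 + k)) * ν h := by
    refine antitone_nat_of_succ_le fun n => ?_
    have := rewardSum_succ_le hγ hν π h n
    rw [Fin.sum_univ_castSucc]
    simp only [Fin.val_castSucc, Fin.val_last]
    linarith
  have hbdd : BddBelow (Set.range fun n => rewardSum γ ν π h n -
      (∑ k : Fin n, γ (h.length + 1 + k)) * ν h) := by
    refine ⟨-(tailSum γ (h.length + 1) * ν h), ?_⟩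
    rintro _ ⟨n, rfl⟩
    have h₁ := rewardSum_nonneg hγ hν π h n
    have h₂ := mul_le_mul_of_nonneg_right (hγ.sum_le_tailSum (h.length + 1) n) (hν.nonneg h)
    dsimp only
    linarith
  have := (tendsto_atTop_ciInf hanti hbdd).add ((hγ.tendsto_sum (h.length + 1)).mul_const (ν h))
  exact ⟨_, this.congr fun n => by ring⟩

theorem exists_value_eq (hγ : IsDiscount γ) (hν : IsSemimeasure ν) (π : Policy) (h : History) :
    ∃ L, Tendsto (rewardSum γ ν π h) atTop (nhds L) ∧
      value γ ν π h = L / (tailSum γ (h.length + 1) * ν h) := by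
  obtain ⟨L, hL⟩ := exists_tendsto_rewardSum hγ hν π h
  refine ⟨L, hL, ?_⟩
  have : Tendsto (fun n : ℕ => ∑ e : Fin n → Percept,
      (∑ k : Fin n, γ (h.length + 1 + k) * reward (e k)) *
        (ν (follow π h (List.ofFn e)) / ν h)) atTop (nhds (L / ν h)) := by
    refine (hL.div_const (ν h)).congr fun n => ?_
    rw [rewardSum, Finset.sum_div]
    exact Finset.sum_congr rfl fun e _ => mul_div_assoc _ _ _
  rw [value, this.limUnder_eq]
  ring

theorem value_le_of_rewardSum_le (hγ : IsDiscount γ) (hν : IsSemimeasure ν) {π : Policy}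
    {h : History} (hpos : 0 < ν h) {c : ℝ}
    (hc : ∀ᶠ n in atTop, rewardSum γ ν π h n ≤ c * (tailSum γ (h.length + 1) * ν h)) :
    value γ ν π h ≤ c := by
  obtain ⟨L, hL, hv⟩ := exists_value_eq hγ hν π h
  rw [hv, div_le_iff₀ (mul_pos (hγ.tailSum_pos _) hpos)]
  exact le_of_tendsto hL hc

/-- The hypothesis has partial discount sums in place of the full tail because a lower bound at a
finite horizon can only see the discounts up to it; the difference vanishes in the limit. -/
theorem le_value_of_le_rewardSum (hγ : IsDiscount γ) (hν : IsSemimeasure ν) {π : Policy}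
    {h : History} (hpos : 0 < ν h) {c : ℝ}
    (hc : ∀ᶠ n in atTop, c * ((∑ k : Fin n, γ (h.length + 1 + k)) * ν h) ≤ rewardSum γ ν π h n) :
    c ≤ value γ ν π h := by
  obtain ⟨L, hL, hv⟩ := exists_value_eq hγ hν π h
  rw [hv, le_div_iff₀ (mul_pos (hγ.tailSum_pos _) hpos)]
  exact le_of_tendsto_of_tendsto (((hγ.tendsto_sum _).mul_const _).const_mul c) hL hc

/-- Needed to use `le_ciSup`. The map `f` is the identity for `optValue` and a `Function.update` for
`optActionValue`. -/
theorem bddAbove_value (hγ : IsDiscount γ) (hν : IsSemimeasure ν) {h : History} (hpos : 0 < ν h)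
    (f : Policy → Policy) : BddAbove (Set.range fun π => value γ ν (f π) h) := by
  refine ⟨1, ?_⟩
  rintro _ ⟨π, rfl⟩
  exact value_le_of_rewardSum_le hγ hν hpos
    (Eventually.of_forall fun n => by rw [one_mul]; exact rewardSum_le hγ hν _ h n)

theorem rewardSum_mul_add (w : ℝ) (μ : History → ℝ) (π : Policy) (h : History) (n : ℕ) :
    rewardSum γ (fun g => w * μ g + ν g) π h n =
      w * rewardSum γ μ π h n + rewardSum γ ν π h n := by
  simp only [rewardSum, Finset.mul_sum, ← Finset.sum_add_distrib]
  exact Finset.sum_congr rfl fun e _ => by ring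

end

/-! ## Values after the histories that encode a query -/

/-- The history in which the first action `false` is taken after `x` actions `true`. -/
def queryHistory (x : ℕ) : History :=
  List.replicate x (true, (false, false)) ++ [(false, (false, false))]

/-- All computations that `x` refers to stop. -/
def Total (x : ℕ) : Prop := ∀ k, ∃ s, query s x k ≠ none

theorem map_fst_queryHistory (x : ℕ) :
    (queryHistory x).map Prod.fst = List.replicate x true ++ [false] := by
  simp [queryHistory]

theorem idxOf_queryHistory_append (x : ℕ) (b : List Action) :
    ((queryHistory x).map Prod.fst ++ b).idxOf false = x := by
  rw [map_fst_queryHistory]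
  induction x with
  | zero => simp
  | succ x ih =>
    rw [List.replicate_succ, List.cons_append, List.cons_append, List.idxOf_cons_ne _ (by decide),
      ih]

theorem choice_queryHistory_append (x : ℕ) (b : List Action) :
    choice ((queryHistory x).map Prod.fst ++ b) = b.head? := by
  rw [choice, idxOf_queryHistory_append, List.getElem?_append_right (by simp [queryHistory])]
  simp [queryHistory, List.head?_eq_getElem?]

theorem percepts_queryHistory_append (x : ℕ) (b : List Action) :
    percepts ((queryHistory x).map Prod.fst ++ b) =
      (queryHistory x).map Prod.snd ++ List.replicate b.length (false, true) := by
  rw [percepts, idxOf_queryHistory_append]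
  apply List.ext_getElem
  · simp [queryHistory]
  · intro k h₁ h₂
    have hq : (queryHistory x).map Prod.snd = List.replicate (x + 1) (false, false) := by
      simp [queryHistory, List.replicate_succ']
    simp only [hq, List.getElem_append, List.getElem_map, List.getElem_range,
      List.getElem_replicate, List.length_replicate]
    split_ifs with hk
    · simp [Nat.lt_succ_iff.1 hk]
    · simp [show x < k by omega]

theorem halts_queryHistory_append (x : ℕ) (b : List Action) (s : ℕ) :
    Halts ((queryHistory x).map Prod.fst ++ b) s ↔
      (b.head? = some true → ∀ k < b.length, query s x k ≠ none) := by
  rw [Halts, choice_queryHistory_append, idxOf_queryHistory_append,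
    show ((queryHistory x).map Prod.fst ++ b).length - (x + 1) = b.length by
      simp [queryHistory, ← Nat.add_assoc]]

theorem possible_queryHistory_append (x : ℕ) (g : History) :
    Possible (queryHistory x ++ g) ↔ g.map Prod.snd = List.replicate g.length (false, true) ∧
      ∃ s, (g.map Prod.fst).head? = some true → ∀ k < g.length, query s x k ≠ none := by
  rw [Possible, List.map_append, List.map_append, percepts_queryHistory_append,
    List.append_cancel_left_eq]
  simp only [halts_queryHistory_append, List.length_map]

theorem dominant_queryHistory (x : ℕ) : dominant (queryHistory x) = 1 := by
  have h := possible_queryHistory_append x []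
  have hc := choice_queryHistory_append x []
  simp only [List.append_nil] at h hc
  exact dominant_eq_one (h.2 ⟨rfl, 0, by simp⟩) (by rw [hc]; simp)

/-- Finitely many halting computations share a time bound, as `evaln` is monotone in the number of
steps. -/
theorem exists_stage {x n : ℕ} (h : ∀ k < n, ∃ s, query s x k ≠ none) :
    ∃ s, ∀ k < n, query s x k ≠ none := by
  induction n with
  | zero => exact ⟨0, by simp⟩
  | succ n ih =>
    obtain ⟨s, hs⟩ := ih fun k hk => h k (by omega)
    obtain ⟨t, ht⟩ := h n (by omega)
    have mono : ∀ {s t k}, s ≤ t → query s x k ≠ none → query t x k ≠ none := by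
      intro s t k hst hk
      obtain ⟨m, hm⟩ := Option.ne_none_iff_exists'.1 hk
      exact Option.ne_none_iff_exists'.2 ⟨m, Nat.Partrec.Code.evaln_mono hst hm⟩
    refine ⟨max s t, fun k hk => ?_⟩
    rcases Nat.lt_succ_iff_lt_or_eq.1 hk with hk | rfl
    · exact mono (le_max_left _ _) (hs k hk)
    · exact mono (le_max_right _ _) ht

theorem exists_follow_succ_eq (π : Policy) (h : History) {n : ℕ} (e : Percept) :
    ∃ g, follow π h (List.replicate (n + 1) e) = h ++ (π h, e) :: g ∧
      ((π h, e) :: g).map Prod.snd = List.replicate (n + 1) e ∧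
      ((π h, e) :: g).length = n + 1 := by
  obtain ⟨g, hg, hs⟩ := exists_follow_eq π (h ++ [(π h, e)]) (List.replicate n e)
  have hl := congrArg List.length hs
  refine ⟨g, ?_, ?_, ?_⟩
  · rw [List.replicate_succ, follow, hg]; simp
  · simp [hs, List.replicate_succ]
  · simpa using hl

/-- The length is `n + 1` because with no further action the choice is still open and the mass is 1.
-/
theorem dominant_follow_false {π : Policy} {x : ℕ} (hπ : π (queryHistory x) = false) (n : ℕ) :
    dominant (follow π (queryHistory x) (List.replicate (n + 1) (false, true))) = 1 / 2 := by
  obtain ⟨g, hg, hs, hl⟩ := exists_follow_succ_eq π (queryHistory x) (n := n) (false, true)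
  rw [hg, hπ]
  rw [hπ] at hs hl
  refine dominant_eq_half ((possible_queryHistory_append _ _).2 ⟨by rw [hs, hl], 0, by simp⟩) ?_
  rw [List.map_append, choice_queryHistory_append]
  simp

theorem dominant_follow_true {π : Policy} {x : ℕ} (hπ : π (queryHistory x) = true)
    (hx : Total x) (n : ℕ) :
    dominant (follow π (queryHistory x) (List.replicate (n + 1) (false, true))) = 1 := by
  obtain ⟨g, hg, hs, hl⟩ := exists_follow_succ_eq π (queryHistory x) (n := n) (false, true)
  rw [hg, hπ]
  rw [hπ] at hs hl
  obtain ⟨s, hst⟩ := exists_stage fun k (_ : k < n + 1) => hx k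
  refine dominant_eq_one ((possible_queryHistory_append _ _).2
    ⟨by rw [hs, hl], s, fun _ => by rwa [hl]⟩) ?_
  rw [List.map_append, choice_queryHistory_append]
  simp

/-- This is where divergence is punished: from some horizon on the mass is zero, so the limit of the
reward sums is zero, whatever was earned before. -/
theorem dominant_follow_eq_zero {π : Policy} {x k : ℕ} (hπ : π (queryHistory x) = true)
    (hx : ∀ s, query s x k = none) {n : ℕ} (hn : k ≤ n) :
    dominant (follow π (queryHistory x) (List.replicate (n + 1) (false, true))) = 0 := by
  obtain ⟨g, hg, hs, hl⟩ := exists_follow_succ_eq π (queryHistory x) (n := n) (false, true)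
  rw [hg, hπ]
  rw [hπ] at hs hl
  refine dominant_eq_zero fun hP => ?_
  obtain ⟨-, s, hst⟩ := (possible_queryHistory_append _ _).1 hP
  exact hst (by simp) k (by omega) (hx s)

/-- After a query only the percept `(false, true)` is possible at each step, so a single percept
sequence carries all the mass. -/
theorem rewardSum_dominant (γ : ℕ → ℝ) (π : Policy) (x n : ℕ) :
    rewardSum γ dominant π (queryHistory x) n =
      (∑ k : Fin n, γ ((queryHistory x).length + 1 + k)) *
        dominant (follow π (queryHistory x) (List.replicate n (false, true))) := by
  rw [rewardSum, Finset.sum_eq_single fun _ => (false, true)]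
  · simp [reward]
  · intro e _ he
    rw [dominant_eq_zero, mul_zero]
    intro hP
    obtain ⟨g, hg, hs⟩ := exists_follow_eq π (queryHistory x) (List.ofFn e)
    rw [hg, possible_queryHistory_append, hs] at hP
    refine he (funext fun i => ?_)
    have hmem : e i ∈ List.ofFn e := List.mem_ofFn.2 ⟨i, rfl⟩
    rw [hP.1] at hmem
    exact List.eq_of_mem_replicate hmem
  · simp

theorem isSemimeasure_mixture : IsSemimeasure universalMachine.mixture :=
  isSemimeasure_mix prior_nonneg summable_prior_and_tsum_le.1

section
variable {γ : ℕ → ℝ} {π : Policy} {x : ℕ}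

/-- Bounds for the mixture and the expected rewards after a query. -/
theorem exists_mixture_bounds (hγ : IsDiscount γ) (x : ℕ) : ∃ w r : ℝ, 31 / 32 ≤ w ∧ 0 ≤ r ∧
    w + r ≤ 1 ∧ universalMachine.mixture (queryHistory x) = w + r ∧ ∀ π n,
      w * rewardSum γ dominant π (queryHistory x) n ≤
        rewardSum γ universalMachine.mixture π (queryHistory x) n ∧
      rewardSum γ universalMachine.mixture π (queryHistory x) n ≤
        w * rewardSum γ dominant π (queryHistory x) n +
          tailSum γ ((queryHistory x).length + 1) * r := by
  obtain ⟨w, ν, hw, hν, hle, heq⟩ := exists_mixture_eq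
  refine ⟨w, ν (queryHistory x), hw, hν.nonneg _, hle _, ?_, fun π n => ?_⟩
  · rw [heq, dominant_queryHistory, mul_one]
  · rw [funext heq, rewardSum_mul_add]
    exact ⟨le_add_of_nonneg_right (rewardSum_nonneg hγ hν _ _ _),
      add_le_add le_rfl (rewardSum_le hγ hν _ _ _)⟩

theorem mixture_queryHistory_pos (x : ℕ) : 0 < universalMachine.mixture (queryHistory x) := by
  obtain ⟨w, ν, hw, hν, -, heq⟩ := exists_mixture_eq
  rw [heq, dominant_queryHistory]
  linarith [hν.nonneg (queryHistory x)]

/-- The dominant part alone contributes `w * d / (w + r)`, and `w ≥ 31/32` while `w + r ≤ 1`. -/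
theorem le_value_of_dominant (hγ : IsDiscount γ) {d : ℝ} (hd : 0 ≤ d)
    (h : ∀ n, dominant (follow π (queryHistory x) (List.replicate (n + 1) (false, true))) = d) :
    31 / 32 * d ≤ value γ universalMachine.mixture π (queryHistory x) := by
  obtain ⟨w, r, hw, hr, hwr, heq, hb⟩ := exists_mixture_bounds hγ x
  refine le_value_of_le_rewardSum hγ isSemimeasure_mixture (mixture_queryHistory_pos x) ?_
  filter_upwards [eventually_ge_atTop 1] with n hn
  obtain ⟨n, rfl⟩ := Nat.exists_eq_add_of_le' hn
  refine le_trans ?_ (hb π (n + 1)).1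
  rw [rewardSum_dominant, h, heq]
  have hG : 0 ≤ ∑ k : Fin (n + 1), γ ((queryHistory x).length + 1 + k) :=
    Finset.sum_nonneg fun _ _ => hγ.nonneg _
  calc _ = (31 / 32 * (w + r)) *
        ((∑ k : Fin (n + 1), γ ((queryHistory x).length + 1 + k)) * d) := by ring
    _ ≤ _ := mul_le_mul_of_nonneg_right (by linarith) (mul_nonneg hG hd)

/-- The rest of the mixture can add at most its own mass `r`, so the value is at most `(w * d + r) /
(w + r)`. -/
theorem value_le_of_dominant (hγ : IsDiscount γ) {d c : ℝ} (hd : 0 ≤ d) (hc : d ≤ c) (hc' : c ≤ 1)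
    (hdc : 31 * d + 1 ≤ 32 * c)
    (h : ∀ᶠ n in atTop,
      dominant (follow π (queryHistory x) (List.replicate n (false, true))) = d) :
    value γ universalMachine.mixture π (queryHistory x) ≤ c := by
  obtain ⟨w, r, hw, hr, hwr, heq, hb⟩ := exists_mixture_bounds hγ x
  refine value_le_of_rewardSum_le hγ isSemimeasure_mixture (mixture_queryHistory_pos x) ?_
  filter_upwards [h] with n hn
  refine (hb π n).2.trans ?_
  rw [rewardSum_dominant, hn, heq]
  have hG := hγ.sum_le_tailSum ((queryHistory x).length + 1) n
  have hΓ := hγ.tailSum_pos ((queryHistory x).length + 1)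
  -- Equivalent to `r * (1 - c) ≤ w * (c - d)`. The worst case is `r = 1/32`, `w = 31/32`, where it
  -- becomes `hdc`.
  have hle : w * d + r ≤ c * (w + r) := by
    nlinarith
  calc _ ≤ w * (tailSum γ ((queryHistory x).length + 1) * d) +
        tailSum γ ((queryHistory x).length + 1) * r := by gcongr
    _ = tailSum γ ((queryHistory x).length + 1) * (w * d + r) := by ring
    _ ≤ tailSum γ ((queryHistory x).length + 1) * (c * (w + r)) :=
        mul_le_mul_of_nonneg_left hle hΓ.le
    _ = _ := by ring

theorem le_value_of_total (hγ : IsDiscount γ) (hx : Total x) (hπ : π (queryHistory x) = true) :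
    31 / 32 ≤ value γ universalMachine.mixture π (queryHistory x) := by
  simpa using le_value_of_dominant hγ zero_le_one (dominant_follow_true hπ hx)

theorem value_le_of_not_total (hγ : IsDiscount γ) (hx : ¬ Total x)
    (hπ : π (queryHistory x) = true) :
    value γ universalMachine.mixture π (queryHistory x) ≤ 1 / 32 := by
  simp only [Total, not_forall, not_exists, not_not] at hx
  obtain ⟨k, hk⟩ := hx
  refine value_le_of_dominant hγ le_rfl (by norm_num) (by norm_num) (by norm_num) ?_
  filter_upwards [eventually_ge_atTop (k + 1)] with n hn
  obtain ⟨n, rfl⟩ := Nat.exists_eq_add_of_le' (show 1 ≤ n by omega)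
  exact dominant_follow_eq_zero hπ hk (by omega)

theorem le_value_of_false (hγ : IsDiscount γ) (hπ : π (queryHistory x) = false) :
    31 / 64 ≤ value γ universalMachine.mixture π (queryHistory x) :=
  le_trans (by norm_num) (le_value_of_dominant hγ (by norm_num) (dominant_follow_false hπ))

theorem value_le_of_false (hγ : IsDiscount γ) (hπ : π (queryHistory x) = false) :
    value γ universalMachine.mixture π (queryHistory x) ≤ 33 / 64 := by
  refine value_le_of_dominant hγ (d := 1 / 2) (by norm_num) (by norm_num) (by norm_num)
    (by norm_num) ?_
  filter_upwards [eventually_ge_atTop 1] with n hn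
  obtain ⟨n, rfl⟩ := Nat.exists_eq_add_of_le' hn
  exact dominant_follow_false hπ n

/-- Changing the action at `queryHistory x` alone is a sufficient competitor. A wrong action earns
at most 33/64 against 31/32, or at most 1/32 against 31/64; either way it loses at least 29/64 >
1/4. -/
theorem IsEpsOptimal.eq_true_iff (hγ : IsDiscount γ)
    (hπ : IsEpsOptimal γ universalMachine.mixture (1 / 4) π) (x : ℕ) :
    Total x ↔ π (queryHistory x) = true := by
  have hle : ∀ a, value γ universalMachine.mixture (Function.update π (queryHistory x) a)
      (queryHistory x) ≤ optValue γ universalMachine.mixture (queryHistory x) := fun a =>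
    le_ciSup (bddAbove_value hγ isSemimeasure_mixture (mixture_queryHistory_pos x) id) _
  have hopt := hπ (queryHistory x)
  constructor
  · intro hx
    by_contra hne
    have h₁ := value_le_of_false hγ (Bool.eq_false_iff.2 hne)
    have h₂ := (le_value_of_total hγ hx (Function.update_self _ _ _)).trans (hle true)
    linarith
  · intro ht
    by_contra hx
    have h₁ := value_le_of_not_total hγ hx ht
    have h₂ := (le_value_of_false hγ (Function.update_self _ _ _)).trans (hle false)
    linarith

/-- The value bounds depend only on the action at `queryHistory x`, so they pass to the suprema. The
two action values are strictly separated there, and tie-breaking plays no role. -/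
theorem IsArgmaxPolicy.eq_true_iff (hγ : IsDiscount γ)
    (hπ : IsArgmaxPolicy γ universalMachine.mixture π) (x : ℕ) :
    Total x ↔ π (queryHistory x) = true := by
  have hle : ∀ a, value γ universalMachine.mixture (Function.update π (queryHistory x) a)
      (queryHistory x) ≤ optActionValue γ universalMachine.mixture (queryHistory x) a := fun a =>
    le_ciSup (bddAbove_value hγ isSemimeasure_mixture (mixture_queryHistory_pos x)
      fun π => Function.update π (queryHistory x) a) π
  constructor
  · intro hx
    by_contra hne
    have h := hπ (queryHistory x) true
    rw [Bool.eq_false_iff.2 hne] at h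
    have h₁ : optActionValue γ universalMachine.mixture (queryHistory x) false ≤ 33 / 64 :=
      ciSup_le fun π => value_le_of_false hγ (Function.update_self _ _ _)
    have h₂ := (le_value_of_total hγ hx (Function.update_self _ _ _)).trans (hle true)
    linarith
  · intro ht
    by_contra hx
    have h := hπ (queryHistory x) false
    rw [ht] at h
    have h₁ : optActionValue γ universalMachine.mixture (queryHistory x) true ≤ 1 / 32 :=
      ciSup_le fun π => value_le_of_not_total hγ hx (Function.update_self _ _ _)
    have h₂ := (le_value_of_false hγ (Function.update_self _ _ _)).trans (hle false)
    linarith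

end

/-! ## Hardness -/

theorem primrec_queryHistory : Primrec queryHistory :=
  (Primrec.list_append.comp (Primrec.list_map Primrec.list_range
    (Primrec.const (true, (false, false))).to₂) (Primrec.const [(false, (false, false))])).of_eq
    fun x => by simp [queryHistory, List.map_const']

theorem total_pair_iff (c : Code) (m : ℕ) :
    Total (Nat.pair (encode c) m) ↔ ∀ k, (eval c (Nat.pair m k)).Dom := by
  refine forall_congr' fun k => ?_
  simp only [query, Nat.unpair_pair, Denumerable.ofNat_encode, Option.ne_none_iff_exists',
    Part.dom_iff_mem, Nat.Partrec.Code.evaln_complete, Option.mem_def]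
  exact exists_comm

/-- `Total` is a universal `Π⁰₂` predicate. -/
theorem IsPi2.exists_code {B : ℕ → Prop} (hB : IsPi2 B) :
    ∃ c : Code, ∀ m, B m ↔ Total (Nat.pair (encode c) m) := by
  obtain ⟨S, ⟨_, hS⟩, h⟩ := hB
  -- `B m` says that for every `k` some `n` refutes `S (m, k, n)`. The search for this `n` is a
  -- partial function of the pair `(m, k)`, and `B m` means that it halts for all `k`.
  have hf : Partrec fun n : ℕ => Nat.rfindOpt fun k : ℕ =>
      bif decide (S (n.unpair.1, n.unpair.2, k)) then none else some 0 :=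
    Partrec.rfindOpt (f := fun n k : ℕ =>
        bif decide (S (n.unpair.1, n.unpair.2, k)) then none else some 0)
      (Computable.cond (hS.comp ((Primrec.fst.comp (Primrec.unpair.comp Primrec.fst)).pair
        ((Primrec.snd.comp (Primrec.unpair.comp Primrec.fst)).pair Primrec.snd)).to_comp)
        (Computable.const none) (Computable.const (some 0)))
  obtain ⟨c, hc⟩ := Nat.Partrec.Code.exists_code.1 (Partrec.nat_iff.1 hf)
  refine ⟨c, fun m => ?_⟩
  rw [total_pair_iff, ← not_iff_not, show ¬ B m ↔ _ from h m, hc]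
  simp only [not_forall]
  refine exists_congr fun k => ?_
  rw [Nat.rfindOpt_dom, Nat.unpair_pair, not_exists]
  refine forall_congr' fun n => ?_
  by_cases hs : S (m, k, n) <;> simp [hs]

theorem IsSigma2.of_manyOneReducible {α β : Type} [Primcodable α] [Primcodable β] {P : α → Prop}
    {Q : β → Prop} (h : ManyOneReducible P Q) (hQ : IsSigma2 Q) : IsSigma2 P := by
  obtain ⟨f, hf, hPQ⟩ := h
  obtain ⟨S, ⟨_, hS⟩, h⟩ := hQ
  refine ⟨fun x => S (f x.1, x.2), ⟨fun _ => inferInstance, hS.comp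
    ((hf.comp Computable.fst).pair Computable.snd)⟩, fun x => (hPQ x).trans (h (f x))⟩

/-- In the `Σ⁰₂` form of the complement, the outer witness is the computation that diverges and the
inner variable is the number of steps. -/
theorem isPi2_total_diagonal : IsPi2 fun n => Total (Nat.pair n n) := by
  classical
  refine ⟨fun x => query x.2.2 (Nat.pair x.1 x.1) x.2.1 = none, ?_, fun n => by simp [Total]⟩
  refine ⟨fun _ => inferInstance, Primrec.to_comp ?_⟩
  have hu : Primrec fun x : ℕ × ℕ × ℕ => (Nat.pair x.1 x.1).unpair :=
    Primrec.unpair.comp (Primrec₂.natPair.comp Primrec.fst Primrec.fst)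
  exact PrimrecPred.decide (Primrec.eq.comp (Nat.Partrec.Code.primrec_evaln.comp
    (((Primrec.snd.comp Primrec.snd).pair ((Primrec.ofNat Code).comp (Primrec.fst.comp hu))).pair
      (Primrec₂.natPair.comp (Primrec.snd.comp hu) (Primrec.fst.comp Primrec.snd))))
    (Primrec.const none))

theorem isPi2Hard_graph {π : Policy} (h : ∀ x, Total x ↔ π (queryHistory x) = true) :
    IsPi2Hard π.graph := by
  intro B hB
  obtain ⟨c, hc⟩ := hB.exists_code
  refine ⟨fun m => (queryHistory (Nat.pair (encode c) m), true), Primrec.to_comp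
    ((primrec_queryHistory.comp (Primrec₂.natPair.comp (Primrec.const _) Primrec.id)).pair
      (Primrec.const true)), fun m => ?_⟩
  exact (hc m).trans (h _)

/-- If `P` were `Σ⁰₂`, so would be the diagonal of `Total`, which reduces to it. The complement of
the diagonal would then be a section of `Total` given by some code, and evaluating at that code's
own number is contradictory. -/
theorem IsPi2Hard.not_isDelta2 {α : Type} [Primcodable α] {P : α → Prop} (h : IsPi2Hard P) :
    ¬ IsDelta2 P := by
  rintro ⟨hP, -⟩
  have hD := hP.of_manyOneReducible (h _ isPi2_total_diagonal)
  obtain ⟨c, hc⟩ := IsPi2.exists_code (B := fun n => ¬ Total (Nat.pair n n))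
    (by simpa only [IsPi2, not_not] using hD)
  exact not_iff_self (hc (encode c))

end AIXI
end

theorem mainTheorem3 :
    ∃ (U : AIXI.UniversalMachine) (ε : ℝ), 0 < ε ∧
      ∀ γ : ℕ → ℝ, AIXI.IsDiscount γ →
        (∀ π : AIXI.Policy, AIXI.IsEpsOptimal γ U.mixture ε π →
          AIXI.IsPi2Hard π.graph ∧ ¬ AIXI.IsDelta2 π.graph) ∧
        (∀ π : AIXI.Policy, AIXI.IsArgmaxPolicy γ U.mixture π →
          AIXI.IsPi2Hard π.graph ∧ ¬ AIXI.IsDelta2 π.graph) := by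
  refine ⟨AIXI.universalMachine, 1 / 4, by norm_num, fun γ hγ => ⟨fun π hπ => ?_, fun π hπ => ?_⟩⟩
  · have h := AIXI.isPi2Hard_graph (hπ.eq_true_iff hγ)
    exact ⟨h, h.not_isDelta2⟩
  · have h := AIXI.isPi2Hard_graph (hπ.eq_true_iff hγ)
    exact ⟨h, h.not_isDelta2⟩
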